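/- Let $X$ be a complex Banach space and let $A$ be the infinitesimal generator of a $C_0$-semigroup $T$ on $X$ such that $$\sigma(A)\cap i\mathbb R=\emptyset ,\qquad \sup_{\lambda\in i\mathbb R}\|(A-\lambda I)^{-1}\|<\infty .$$ Let $\mathcal F=C_b(\mathbb R,X)$ be the space of bounded continuous functions with the sup-norm. For $a\in\mathbb R$ let $\phi_a\in L^1(\mathbb R)$ be the function with Fourier transform $\int\phi_a(t)e^{-it\lambda}\,dt=\max(1-|\lambda-a|,0)$, and put $$\mathcal F_{as}=\Big\{x\in\mathcal F:\ \int_{\mathbb R}\|\phi_a*x\|_\infty\,da<\infty\Big\},\qquad \|x\|_{as}=5\sum_{m\in\mathbb Z}\|\phi_m*x\|_\infty .$$ Let $\mathscr L=-\frac{d}{dt}+A$ be the operator in $\mathcal F_{as}$ defined as follows: for $x,y\in\mathcal F_{as}$, $x\in D(\mathscr L)$ and $\mathscr Lx=y$ mean that $x(t)=T(t-s)x(s)-\int_s^tT(t-\tau)y(\tau)\,d\tau$ for all $s\le t$. Let $F(v)=F_1(v)+F_2(v,v)+\dots+F_n(v,\dots,v)$, $v\in X$, where each $F_k:X^k\to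 X$ is a bounded $k$-linear map, and write $F(x)$ also for the function $t\mapsto F(x(t))$. Then $\mathscr L$ is a bijection of $D(\mathscr L)$ onto $\mathcal F_{as}$ and $F$ maps $\mathcal F_{as}$ into itself, so that $\Phi=\mathscr L^{-1}\circ F:\mathcal F_{as}\to\mathcal F_{as}$ is well defined. For $y\in\mathcal F_{as}$ put $z=\mathscr L^{-1}y$. A mild solution of the non-linear equation $\mathscr Lx=y+F(x)$ is an $x\in\mathcal F_{as}$ with $x=z+\Phi(x)$. (This is the mild form of $Ax-x'=y+F(x)$, and it turns into $x'=Ax+y+F(x)$ when $(y,F)$ is replaced by $(-y,-F)$.) Let $\beta>0$ and $y\in\mathcal F_{as}$, let $L=L_{F,A}(\beta)\ge 0$ be a Lipschitz constant of $\Phi$ on the ball of radius $\beta$ centered at $z$, that is, $$\|\Phi(u)-\Phi(v)\|_{as}\le L\,\|u-v\|_{as}\quad\text{for all }u,v\in\mathcal F_{as}\text{ with }\|u-z\|_{as}<\beta,\ \|v-z\|_{as}<\beta ,$$ and suppose that $L<1$ and $\|\Phi(z)\|_{as}<\beta(1-L)$. Then there is a unique mild solution $x\in\mathcal F_{as}$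 satisfying $\|x-z\|_{as}\le\beta$. -/

import Mathlib

open Filter Topology MeasureTheory
open scoped NNReal ENNReal BoundedContinuousFunction

namespace ParabolicAS

variable {X : Type*} [NormedAddCommGroup X] [NormedSpace ℂ X]

/-! ### Semigroups, generators, resolvents -/

/-- `T` is a `C₀`-semigroup of bounded operators on `X`. -/
structure IsC0Semigroup (T : ℝ≥0 → X →L[ℂ] X) : Prop where
  map_zero : T 0 = ContinuousLinearMap.id ℂ X
  map_add : ∀ s t : ℝ≥0, T (s + t) = (T s).comp (T t)
  strongly_continuous : ∀ v : X, Continuous fun t : ℝ≥0 => T t v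

/-- `lim_{h → 0+} (T(h)v - v) / h = w`. -/
def HasGenerator (T : ℝ≥0 → X →L[ℂ] X) (v w : X) : Prop :=
  Tendsto (fun h : ℝ≥0 => (((h : ℝ) : ℂ)⁻¹) • (T h v - v)) (𝓝[>] 0) (𝓝 w)

theorem HasGenerator.add {T : ℝ≥0 → X →L[ℂ] X} {v w v' w' : X}
    (h : HasGenerator T v w) (h' : HasGenerator T v' w') :
    HasGenerator T (v + v') (w + w') := by
  unfold HasGenerator at *
  refine (Tendsto.add h h').congr fun s => ?_
  rw [← smul_add, map_add]
  congr 1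
  abel

theorem HasGenerator.smul {T : ℝ≥0 → X →L[ℂ] X} {v w : X} (c : ℂ)
    (h : HasGenerator T v w) : HasGenerator T (c • v) (c • w) := by
  unfold HasGenerator at *
  refine (Tendsto.const_smul h c).congr fun s => ?_
  rw [map_smul, ← smul_sub, smul_comm]

theorem HasGenerator.unique {T : ℝ≥0 → X →L[ℂ] X} {v w w' : X}
    (h : HasGenerator T v w) (h' : HasGenerator T v w') : w = w' :=
  tendsto_nhds_unique h h'

/-- The infinitesimal generator of `T`, an unbounded operator on `X`. -/
noncomputable def generator (T : ℝ≥0 → X →L[ℂ] X) : X →ₗ.[ℂ] X where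
  domain :=
    { carrier := {v | ∃ w, HasGenerator T v w}
      add_mem' := fun ⟨_, h⟩ ⟨_, h'⟩ => ⟨_, h.add h'⟩
      zero_mem' := ⟨0, by simp [HasGenerator]⟩
      smul_mem' := fun c _ ⟨_, h⟩ => ⟨_, h.smul c⟩ }
  toFun :=
    { toFun := fun v => Classical.choose v.2
      map_add' := fun v v' => HasGenerator.unique (Classical.choose_spec (v + v').2)
        ((Classical.choose_spec v.2).add (Classical.choose_spec v'.2))
      map_smul' := fun c v => HasGenerator.unique (Classical.choose_spec (c • v).2)
        ((Classical.choose_spec v.2).smul c) }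

/-- The bounded operator `R` is the inverse `(A - μ I)⁻¹` of `A - μ I : D(A) → X`. -/
def IsResolventAt (A : X →ₗ.[ℂ] X) (μ : ℂ) (R : X →L[ℂ] X) : Prop :=
  (∀ v : X, ∃ h : R v ∈ A.domain, A ⟨R v, h⟩ - μ • R v = v) ∧
    ∀ v : A.domain, R (A v - μ • (v : X)) = v

/-- The spectrum of an unbounded operator. -/
def opSpectrum (A : X →ₗ.[ℂ] X) : Set ℂ := {μ | ¬ ∃ R : X →L[ℂ] X, IsResolventAt A μ R}

/-- The imaginary axis. -/
def imagAxis : Set ℂ := {μ | μ.re = 0}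

/-- `sup_{μ ∈ iℝ} ‖(A - μ I)⁻¹‖ < ∞`. -/
def ResolventBddOnImagAxis (A : X →ₗ.[ℂ] X) : Prop :=
  ∃ M : ℝ, ∀ μ ∈ imagAxis, ∀ R : X →L[ℂ] X, IsResolventAt A μ R → ‖R‖ ≤ M

/-! ### Functions with absolutely summable spectrum -/

/-- `(1 - |l|) χ_{[-1,1]}(l)`. -/
noncomputable def triangle (l : ℝ) : ℝ := Set.indicator (Set.Icc (-1) 1) (fun l => 1 - |l|) l

/-- The function `φ_a ∈ L¹(ℝ)` whose Fourier transform (`∫ f(t) e^{-itl} dt`) is the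
translated triangle `l ↦ triangle (l - a)`, given by Fourier inversion. -/
noncomputable def phi (a t : ℝ) : ℂ :=
  (1 / (2 * Real.pi) : ℂ) *
    ∫ l : ℝ, (triangle (l - a) : ℂ) * Complex.exp (Complex.I * (l : ℂ) * (t : ℂ))

/-- The convolution `φ_a * x`. -/
noncomputable def phiConv (a : ℝ) (x : ℝ →ᵇ X) (t : ℝ) : X := ∫ s : ℝ, phi a s • x (t - s)

/-- The supremum norm of `φ_a * x`, in `[0, ∞]`. -/
noncomputable def phiConvNorm (a : ℝ) (x : ℝ →ᵇ X) : ℝ≥0∞ := ⨆ t : ℝ, ‖phiConv a x t‖ₑ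

/-- Membership in the subspace `F_as` of `F = C_b(ℝ, X)`: `∫ ‖φ_a * x‖_∞ da < ∞`. -/
def MemAS (x : ℝ →ᵇ X) : Prop := ∫⁻ a : ℝ, phiConvNorm a x < ∞

/-- The norm `‖x‖_as = 5 ∑_{n ∈ ℤ} ‖φ_n * x‖_∞` of `F_as`, with values in `[0, ∞]`. -/
noncomputable def asNorm (x : ℝ →ᵇ X) : ℝ≥0∞ := 5 * ∑' n : ℤ, phiConvNorm (n : ℝ) x

/-- The open ball of `F_as` with centre `c` and radius `r`. -/
def asBall (c : ℝ →ᵇ X) (r : ℝ) : Set (ℝ →ᵇ X) :=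
  {x | MemAS x ∧ asNorm (x - c) < ENNReal.ofReal r}

/-! ### The differential operator `-d/dt + A` -/

/-- `x` is in the domain of the operator `L = -d/dt + A` of `F_as`, and `L x = y`. -/
def IsL (T : ℝ≥0 → X →L[ℂ] X) (x y : ℝ →ᵇ X) : Prop :=
  MemAS x ∧ MemAS y ∧ ∀ s t : ℝ, s ≤ t →
    x t = T (t - s).toNNReal (x s) - ∫ τ in s..t, T (t - τ).toNNReal (y τ)

open Classical in
/-- The inverse of the operator `L` of `F_as` (with value `0` off the range of `L`). -/
noncomputable def LInv (T : ℝ≥0 → X →L[ℂ] X) (y : ℝ →ᵇ X) : ℝ →ᵇ X :=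
  if h : ∃ x, IsL T x y then Classical.choose h else 0

/-! ### The non-linear term -/

/-- `F(v) = F₁(v) + F₂(v, v) + ⋯ + Fₙ(v, …, v)`. -/
def poly (n : ℕ) (F : (k : ℕ) → ContinuousMultilinearMap ℂ (fun _ : Fin k => X) X) (v : X) : X :=
  ∑ k ∈ Finset.Icc 1 n, F k fun _ => v

theorem continuous_poly (n : ℕ)
    (F : (k : ℕ) → ContinuousMultilinearMap ℂ (fun _ : Fin k => X) X) :
    Continuous (poly n F) := by
  unfold poly
  exact continuous_finsetSum _ fun k _ => (F k).cont.comp (continuous_pi fun _ => continuous_id)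

theorem norm_poly_le (n : ℕ)
    (F : (k : ℕ) → ContinuousMultilinearMap ℂ (fun _ : Fin k => X) X) {v : X} {r : ℝ}
    (hv : ‖v‖ ≤ r) : ‖poly n F v‖ ≤ ∑ k ∈ Finset.Icc 1 n, ‖F k‖ * r ^ k := by
  unfold poly
  refine (norm_sum_le _ _).trans (Finset.sum_le_sum fun k _ => ?_)
  refine ((F k).le_opNorm _).trans ?_
  rw [Finset.prod_const, Finset.card_univ, Fintype.card_fin]
  gcongr

/-- The map `x ↦ F(x(·))` on `C_b(ℝ, X)`. -/
noncomputable def polyComp (n : ℕ)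
    (F : (k : ℕ) → ContinuousMultilinearMap ℂ (fun _ : Fin k => X) X) (x : ℝ →ᵇ X) : ℝ →ᵇ X :=
  BoundedContinuousFunction.ofNormedAddCommGroup (fun t => poly n F (x t))
    ((continuous_poly n F).comp x.continuous) (∑ k ∈ Finset.Icc 1 n, ‖F k‖ * ‖x‖ ^ k)
    (fun t => norm_poly_le n F (x.norm_coe_le_norm t))

/-- The non-linear map `Φ = L⁻¹ ∘ F`. -/
noncomputable def Phi (T : ℝ≥0 → X →L[ℂ] X) (n : ℕ)
    (F : (k : ℕ) → ContinuousMultilinearMap ℂ (fun _ : Fin k => X) X) (x : ℝ →ᵇ X) : ℝ →ᵇ X :=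
  LInv T (polyComp n F x)

/-- `K` is a Lipschitz constant, in the norm of `F_as`, of `Φ` on the set `B`. -/
def AsLipschitzOn (K : ℝ≥0) (Φ : (ℝ →ᵇ X) → ℝ →ᵇ X) (B : Set (ℝ →ᵇ X)) : Prop :=
  ∀ u ∈ B, ∀ v ∈ B, asNorm (Φ u - Φ v) ≤ K * asNorm (u - v)

/-- `x ∈ F_as` is a mild solution of the non-linear equation: `x = z + Φ(x)` with `z = L⁻¹ y`. -/
def IsMildSolution (T : ℝ≥0 → X →L[ℂ] X) (n : ℕ)
    (F : (k : ℕ) → ContinuousMultilinearMap ℂ (fun _ : Fin k => X) X) (y x : ℝ →ᵇ X) : Prop :=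
  MemAS x ∧ x = LInv T y + Phi T n F x

end ParabolicAS

/-!
The identity `φ_a = φ_a * (φ_{b-2} + φ_{b-1} + φ_b + φ_{b+1})`, valid for `b - 1 ≤ a ≤ b`, makes the
integral defining `F_as` comparable with the sum defining `‖·‖_as`, and shows that `x ∈ F_as` is the
absolutely convergent sum of the pieces `φ_n * x`. Hence `F_as` is a Banach space, and since the
product of pieces with spectra near `n` and `m` has its spectrum near `n + m`, superposition with
a polynomial acts continuously on it.

The convolution with the inverse Fourier transform of the symbol `l ↦ triangle (l - n) • R l`, where
`R l = (A - i l)⁻¹`, solves `ℒ x = φ_n * y`. Inserting a smooth cutoff `χ (l - n)` equal to `1` on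
the support of the triangle, its norm is at most `‖φ_n * y‖` times the `L¹` norm of the kernel with
symbol `χ (l - n) • R l`, which is bounded uniformly in `n` because `R`, `R'` and `R''` are bounded.
Summation over `n` inverts `ℒ` boundedly. The inverse is unique because every `φ_a * x` is
recovered from `ℒ x` by a multiplier commuting with `T`. The contraction principle on the closed
ball around `z` then applies to `x ↦ z + Φ x`.
-/

namespace ParabolicAS

open Complex (I exp)
open scoped FourierTransform

/-! ### The Fourier transform in angular frequency -/

section AngularFourier

variable {E : Type*} [NormedAddCommGroup E] [NormedSpace ℂ E]

/-- The Fourier transform of `h` in angular frequency, the normalization in which the statement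
prescribes the transform of `phi a`. -/
noncomputable def angFourier (h : ℝ → E) (l : ℝ) : E :=
  ∫ s : ℝ, exp (-(I * l * s)) • h s

/-- The inverse of `angFourier`. It turns a symbol `f` into the kernel of the convolution operator
with this symbol. -/
noncomputable def angFourierInv (f : ℝ → E) (t : ℝ) : E :=
  (1 / (2 * Real.pi) : ℂ) • ∫ l : ℝ, exp (I * l * t) • f l

theorem norm_exp_I_mul (l t : ℝ) : ‖exp (I * l * t)‖ = 1 := by
  rw [mul_assoc, mul_comm, ← Complex.ofReal_mul, Complex.norm_exp_ofReal_mul_I]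

theorem integrable_exp_smul {f : ℝ → E} (hf : Integrable f) (t : ℝ) :
    Integrable fun l : ℝ => exp (I * l * t) • f l :=
  hf.bdd_smul 1 (Continuous.aestronglyMeasurable (by fun_prop))
    (ae_of_all _ fun l => (norm_exp_I_mul l t).le)

theorem angFourierInv_eq_fourierInv (f : ℝ → E) (t : ℝ) :
    angFourierInv f t = (1 / (2 * Real.pi) : ℂ) • 𝓕⁻ f (t / (2 * Real.pi)) := by
  rw [angFourierInv, Real.fourierInv_eq']
  congr! 5 with l
  simp only [RCLike.inner_apply, Real.ringHom_apply, Complex.ofReal_mul, Complex.ofReal_ofNat,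
    Complex.ofReal_div]
  field

theorem angFourierInv_eq_fourier (f : ℝ → E) (t : ℝ) :
    angFourierInv f t = (1 / (2 * Real.pi) : ℂ) • 𝓕 f (-(t / (2 * Real.pi))) := by
  rw [angFourierInv_eq_fourierInv, Real.fourierInv_eq_fourier_neg]

theorem continuous_angFourierInv {f : ℝ → E} (hf : Integrable f) :
    Continuous (angFourierInv f) :=
  .const_smul (continuous_of_dominated (bound := fun l => ‖f l‖)
    (fun t => (integrable_exp_smul hf t).1)
    (fun t => ae_of_all _ fun l => by rw [norm_smul, norm_exp_I_mul, one_mul])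
    hf.norm (ae_of_all _ fun l => by fun_prop)) _

theorem norm_inv_two_pi_le_one : ‖(1 / (2 * Real.pi) : ℂ)‖ ≤ 1 := by
  rw [norm_div, norm_one, norm_mul, RCLike.norm_ofNat, Complex.norm_real,
    Real.norm_of_nonneg Real.pi_pos.le, div_le_one (by positivity)]
  linarith [Real.pi_gt_three]

theorem norm_angFourierInv_le (f : ℝ → E) (t : ℝ) : ‖angFourierInv f t‖ ≤ ∫ l, ‖f l‖ :=
  calc ‖angFourierInv f t‖
      ≤ ‖∫ l : ℝ, exp (I * l * t) • f l‖ := by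
        rw [angFourierInv, norm_smul]
        exact mul_le_of_le_one_left (norm_nonneg _) norm_inv_two_pi_le_one
    _ ≤ ∫ l, ‖f l‖ := by
        simpa only [norm_smul, norm_exp_I_mul, one_mul] using
          norm_integral_le_integral_norm fun l : ℝ => exp (I * l * t) • f l

theorem angFourierInv_comp_sub_right (f : ℝ → E) (a t : ℝ) :
    angFourierInv (fun l => f (l - a)) t = exp (I * a * t) • angFourierInv f t := by
  rw [angFourierInv, angFourierInv, smul_comm (exp _), ← integral_smul (exp _),
    ← integral_add_right_eq_self (fun l : ℝ => exp (I * l * t) • f (l - a)) a]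
  congr! 3 with _
  rw [add_sub_cancel_right, smul_smul, ← Complex.exp_add]
  congr 2
  push_cast
  ring

theorem integrable_fourier_of_integrable_angFourierInv {f : ℝ → E}
    (hf : Integrable (angFourierInv f)) : Integrable (𝓕 f) := by
  have h := (hf.comp_mul_left' (R := -(2 * Real.pi)) (by simp [Real.pi_ne_zero])).smul
    (2 * Real.pi : ℂ)
  refine h.congr (ae_of_all _ fun v => ?_)
  have hv : -(-(2 * Real.pi) * v / (2 * Real.pi)) = v := by field
  rw [Pi.smul_apply, angFourierInv_eq_fourier, hv, smul_smul, mul_one_div_cancel, one_smul]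
  simp [Real.pi_ne_zero]

theorem angFourier_angFourierInv [CompleteSpace E] {f : ℝ → E} (hf : Continuous f)
    (hi : Integrable f) (hg : Integrable (angFourierInv f)) (l : ℝ) :
    angFourier (angFourierInv f) l = f l := by
  have hinv := congrFun
    (hf.fourier_fourierInv_eq hi (integrable_fourier_of_integrable_angFourierInv hg)) l
  rw [Real.fourier_eq'] at hinv
  have hscale := Measure.integral_comp_mul_left
    (fun s : ℝ => exp (-(I * l * s)) • angFourierInv f s) (2 * Real.pi)
  rw [abs_of_pos (by positivity), eq_comm, inv_smul_eq_iff₀ (by positivity)] at hscale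
  rw [angFourier, hscale, ← integral_smul, ← hinv]
  refine integral_congr_ae (ae_of_all _ fun v => ?_)
  have hv : 2 * Real.pi * v / (2 * Real.pi) = v := by field
  have hexp : exp (-(I * l * ((2 * Real.pi * v : ℝ) : ℂ)))
      = exp (((-2 * Real.pi * inner ℝ v l : ℝ) : ℂ) * I) := by
    congr 1
    simp only [Complex.ofReal_mul, Complex.ofReal_ofNat, neg_mul, RCLike.inner_apply,
      Real.ringHom_apply, Complex.ofReal_neg, neg_inj]
    ring
  simp only [angFourierInv_eq_fourierInv, hv, hexp]
  rw [smul_comm _ (1 / _ : ℂ), ← Complex.coe_smul, smul_smul _ (1 / _ : ℂ),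
    Complex.ofReal_mul, Complex.ofReal_ofNat, mul_one_div_cancel, one_smul]
  simp [Real.pi_ne_zero]

theorem integrable_uncurry_smul_exp_smul {h : ℝ → ℂ} {f : ℝ → E} (hh : Integrable h)
    (hf : Integrable f) (t : ℝ) :
    Integrable (Function.uncurry fun s l : ℝ => h s • exp (I * l * ((t - s : ℝ) : ℂ)) • f l)
      (volume.prod volume) := by
  refine ((hh.smul_prod hf).bdd_smul
    (φ := fun p : ℝ × ℝ => exp (I * p.2 * ((t - p.1 : ℝ) : ℂ))) 1
    (Continuous.aestronglyMeasurable (by fun_prop))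
    (ae_of_all _ fun p => (norm_exp_I_mul _ _).le)).congr (ae_of_all _ fun p => ?_)
  exact smul_comm _ _ _

theorem integral_smul_angFourierInv_sub [CompleteSpace E] {h : ℝ → ℂ} {f : ℝ → E}
    (hh : Integrable h) (hf : Integrable f) (t : ℝ) :
    ∫ s, h s • angFourierInv f (t - s) = angFourierInv (fun l => angFourier h l • f l) t := by
  have hexp (s l : ℝ) : h s • exp (I * l * ((t - s : ℝ) : ℂ)) • f l
      = exp (I * l * t) • (exp (-(I * l * s)) • h s) • f l := by
    rw [smul_smul, smul_smul, smul_eq_mul, ← mul_assoc, ← Complex.exp_add, mul_comm]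
    congr 3
    push_cast
    ring
  calc ∫ s, h s • angFourierInv f (t - s)
      = (1 / (2 * Real.pi) : ℂ) •
          ∫ s : ℝ, ∫ l : ℝ, h s • exp (I * l * ((t - s : ℝ) : ℂ)) • f l := by
        simp only [angFourierInv, integral_smul, smul_comm (h _) (1 / _ : ℂ)]
    _ = (1 / (2 * Real.pi) : ℂ) •
          ∫ l : ℝ, ∫ s : ℝ, h s • exp (I * l * ((t - s : ℝ) : ℂ)) • f l := by
        rw [integral_integral_swap (integrable_uncurry_smul_exp_smul hh hf t)]
    _ = angFourierInv (fun l => angFourier h l • f l) t := by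
        simp_rw [hexp, angFourierInv, angFourier, integral_smul, integral_smul_const]

end AngularFourier

/-! ### The triangle and its kernel -/

section Triangle

theorem triangle_eq_max (l : ℝ) : triangle l = max (1 - |l|) 0 := by
  rw [triangle, Set.indicator_apply]
  simp only [Set.mem_Icc, ← abs_le]
  split_ifs with h
  · rw [max_eq_left (by linarith)]
  · rw [max_eq_right (by linarith)]

@[fun_prop]
theorem continuous_triangle : Continuous triangle := by
  simp_rw [funext triangle_eq_max]
  fun_prop

theorem triangle_nonneg (l : ℝ) : 0 ≤ triangle l :=
  triangle_eq_max l ▸ le_max_right _ _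

theorem triangle_of_one_le {l : ℝ} (h : 1 ≤ |l|) : triangle l = 0 := by
  rw [triangle_eq_max, max_eq_right (by linarith)]

theorem hasCompactSupport_triangle : HasCompactSupport triangle :=
  .of_support_subset_isCompact isCompact_Icc Set.support_indicator_subset

theorem integrable_triangle : Integrable triangle :=
  continuous_triangle.integrable_of_hasCompactSupport hasCompactSupport_triangle

theorem sum_triangle_eq_one {b l : ℝ} (h1 : b - 2 ≤ l) (h2 : l ≤ b + 1) :
    ∑ j ∈ Finset.range 4, triangle (l - (b - 2 + j)) = 1 := by
  simp only [Finset.sum_range_succ, Finset.sum_range_zero, triangle_eq_max]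
  push_cast
  grind

end Triangle

section Phi

theorem integrable_triangle_sub (a : ℝ) : Integrable fun l => (triangle (l - a) : ℂ) :=
  (integrable_triangle.comp_sub_right a).ofReal

theorem phi_eq_angFourierInv (a : ℝ) :
    phi a = angFourierInv fun l => (triangle (l - a) : ℂ) := by
  ext t
  simp only [phi, angFourierInv, smul_eq_mul, mul_comm]

theorem continuous_phi (a : ℝ) : Continuous (phi a) :=
  phi_eq_angFourierInv a ▸ continuous_angFourierInv (integrable_triangle_sub a)

theorem phi_eq_exp_mul (a t : ℝ) : phi a t = exp (I * a * t) * phi 0 t := by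
  simp only [phi_eq_angFourierInv, sub_zero]
  exact angFourierInv_comp_sub_right (fun l => (triangle l : ℂ)) a t

theorem norm_phi (a t : ℝ) : ‖phi a t‖ = ‖phi 0 t‖ := by
  rw [phi_eq_exp_mul, norm_mul, norm_exp_I_mul, one_mul]

theorem phi_zero_eq_integral_cos (t : ℝ) :
    phi 0 t = (1 / (2 * Real.pi) : ℂ) * (∫ l, triangle l * Real.cos (l * t) : ℝ) := by
  have hi : Integrable fun l : ℝ => (triangle l : ℂ) * exp (I * l * t) := by
    simpa only [sub_zero, mul_comm, smul_eq_mul] using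
      integrable_exp_smul (integrable_triangle_sub 0) t
  have hsymm (l : ℝ) : (triangle l : ℂ) * exp (I * l * t)
      + (triangle (-l) : ℂ) * exp (I * (-l : ℝ) * t)
      = 2 * ((triangle l * Real.cos (l * t) : ℝ) : ℂ) := by
    have hcos : 2 * Complex.cos (l * t) = exp (I * l * t) + exp (-(I * l * t)) := by
      rw [Complex.two_cos]
      ring_nf
    rw [triangle_eq_max, triangle_eq_max, abs_neg]
    push_cast
    rw [mul_left_comm, hcos]
    ring_nf
  have hdouble : 2 * ∫ l : ℝ, (triangle l : ℂ) * exp (I * l * t)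
      = 2 * ((∫ l, triangle l * Real.cos (l * t) : ℝ) : ℂ) := by
    calc 2 * ∫ l : ℝ, (triangle l : ℂ) * exp (I * l * t)
        = ∫ l : ℝ, ((triangle l : ℂ) * exp (I * l * t)
            + (triangle (-l) : ℂ) * exp (I * (-l : ℝ) * t)) := by
          rw [integral_add hi hi.comp_neg, two_mul,
            integral_neg_eq_self fun l : ℝ => (triangle l : ℂ) * exp (I * l * t)]
      _ = 2 * ((∫ l, triangle l * Real.cos (l * t) : ℝ) : ℂ) := by
          simp_rw [hsymm]
          rw [integral_const_mul, integral_complex_ofReal]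
  rw [phi, ← mul_left_cancel₀ two_ne_zero hdouble]
  simp only [sub_zero]

theorem integral_one_sub_mul_cos {t : ℝ} (ht : t ≠ 0) :
    ∫ l in (0 : ℝ)..1, (1 - l) * Real.cos (l * t) = (1 - Real.cos t) / t ^ 2 := by
  rw [intervalIntegral.integral_eq_sub_of_hasDerivAt
    (f := fun l => (1 - l) * Real.sin (l * t) / t - Real.cos (l * t) / t ^ 2)]
  · simp
    ring
  · intro l _
    have hlt : HasDerivAt (fun l : ℝ => l * t) t l := hasDerivAt_mul_const t
    refine (((((hasDerivAt_id' l).const_sub 1).mul hlt.sin).div_const t).sub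
      (hlt.cos.div_const (t ^ 2))).congr_deriv ?_
    field
  · exact Continuous.intervalIntegrable (by fun_prop) _ _

theorem integral_triangle_mul_cos {t : ℝ} (ht : t ≠ 0) :
    ∫ l, triangle l * Real.cos (l * t) = 2 * (1 - Real.cos t) / t ^ 2 := by
  have hrestrict : ∫ l in Set.Ioi (0 : ℝ), triangle l * Real.cos (l * t)
      = ∫ l in Set.Ioc (0 : ℝ) 1, (1 - l) * Real.cos (l * t) := by
    rw [← integral_indicator measurableSet_Ioi, ← integral_indicator measurableSet_Ioc]
    congr! 2 with l
    simp only [Set.indicator_apply, Set.mem_Ioi, Set.mem_Ioc, triangle_eq_max]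
    grind
  calc ∫ l, triangle l * Real.cos (l * t) = ∫ l, triangle |l| * Real.cos (|l| * t) := by
        congr! 2 with l
        rw [triangle_eq_max, triangle_eq_max, abs_abs, ← Real.cos_abs, abs_mul,
          ← Real.cos_abs (|l| * t), abs_mul, abs_abs]
    _ = 2 * ∫ l in Set.Ioi (0 : ℝ), triangle l * Real.cos (l * t) :=
        integral_comp_abs (f := fun l => triangle l * Real.cos (l * t))
    _ = 2 * (1 - Real.cos t) / t ^ 2 := by
        rw [hrestrict, ← intervalIntegral.integral_of_le zero_le_one,
          integral_one_sub_mul_cos ht, mul_div_assoc]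

theorem sq_mul_norm_phi_zero_le (t : ℝ) : t ^ 2 * ‖phi 0 t‖ ≤ 4 := by
  rcases eq_or_ne t 0 with rfl | ht
  · simp
  have hnum : 0 ≤ 2 * (1 - Real.cos t) := by linarith [Real.cos_le_one t]
  calc t ^ 2 * ‖phi 0 t‖ ≤ t ^ 2 * (2 * (1 - Real.cos t) / t ^ 2) := by
        rw [phi_zero_eq_integral_cos, integral_triangle_mul_cos ht, norm_mul, Complex.norm_real,
          Real.norm_of_nonneg (by positivity)]
        gcongr
        exact mul_le_of_le_one_left (by positivity) norm_inv_two_pi_le_one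
    _ = 2 * (1 - Real.cos t) := mul_div_cancel₀ _ (by positivity)
    _ ≤ 4 := by linarith [Real.neg_one_le_cos t]

theorem integrable_phi (a : ℝ) : Integrable (phi a) := by
  refine (integrable_inv_one_add_sq.const_mul ((∫ l, ‖(triangle (l - 0) : ℂ)‖) + 4)).mono'
    (continuous_phi a).aestronglyMeasurable (ae_of_all _ fun t => ?_)
  have hsup : ‖phi 0 t‖ ≤ ∫ l, ‖(triangle (l - 0) : ℂ)‖ :=
    phi_eq_angFourierInv 0 ▸ norm_angFourierInv_le _ t
  rw [norm_phi, ← div_eq_mul_inv, le_div_iff₀ (by positivity)]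
  linarith [sq_mul_norm_phi_zero_le t]

theorem angFourier_phi (a l : ℝ) : angFourier (phi a) l = (triangle (l - a) : ℂ) := by
  have hi := integrable_phi a
  rw [phi_eq_angFourierInv] at hi ⊢
  exact angFourier_angFourierInv (by fun_prop) (integrable_triangle_sub a) hi l

theorem phi_zero_zero_ne_zero : phi 0 0 ≠ 0 := by
  have hpos : 0 < ∫ l, triangle l :=
    continuous_triangle.integral_pos_of_hasCompactSupport_nonneg_nonzero
      hasCompactSupport_triangle triangle_nonneg (x := 0) (by simp [triangle_eq_max])
  rw [phi_zero_eq_integral_cos]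
  simp [Real.pi_ne_zero, hpos.ne']

/-- The common `L¹`-norm of the kernels `phi a`, a bound for the operators `phi a * ·`. -/
noncomputable def phiL1 : ℝ := ∫ t, ‖phi 0 t‖

theorem phiL1_nonneg : 0 ≤ phiL1 := integral_nonneg fun _ => norm_nonneg _

theorem integral_norm_phi (a : ℝ) : ∫ t, ‖phi a t‖ = phiL1 := by
  simp only [norm_phi a, phiL1]

end Phi

/-! ### Convolution operators on `C_b(ℝ, X)` -/

section ConvOp

variable {X : Type*} [NormedAddCommGroup X] [NormedSpace ℂ X]

theorem norm_kernel_apply_le (K : ℝ → X →L[ℂ] X) (x : ℝ →ᵇ X) (s t : ℝ) :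
    ‖K s (x t)‖ ≤ ‖K s‖ * ‖x‖ :=
  (K s).le_opNorm_of_le (x.norm_coe_le_norm t)

theorem integrable_kernel_apply {K : ℝ → X →L[ℂ] X} (hK : Integrable K) (x : ℝ →ᵇ X) (t : ℝ) :
    Integrable fun s => K s (x (t - s)) :=
  (hK.norm.mul_const ‖x‖).mono'
    ((ContinuousLinearMap.id ℂ (X →L[ℂ] X)).aestronglyMeasurable_comp₂ hK.1
      (x.continuous.comp (continuous_const.sub continuous_id)).aestronglyMeasurable)
    (ae_of_all _ fun s => norm_kernel_apply_le K x s _)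

theorem norm_integral_kernel_le {K : ℝ → X →L[ℂ] X} (hK : Integrable K) (x : ℝ →ᵇ X) (t : ℝ) :
    ‖∫ s, K s (x (t - s))‖ ≤ (∫ s, ‖K s‖) * ‖x‖ :=
  integral_mul_const ‖x‖ (fun s => ‖K s‖) ▸ norm_integral_le_of_norm_le (hK.norm.mul_const ‖x‖)
    (ae_of_all _ fun s => norm_kernel_apply_le K x s _)

theorem continuous_integral_kernel {K : ℝ → X →L[ℂ] X} (hK : Integrable K) (x : ℝ →ᵇ X) :
    Continuous fun t => ∫ s, K s (x (t - s)) :=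
  continuous_of_dominated (fun t => (integrable_kernel_apply hK x t).1)
    (fun _ => ae_of_all _ fun s => norm_kernel_apply_le K x s _) (hK.norm.mul_const ‖x‖)
    (ae_of_all _ fun s =>
      (K s).continuous.comp (x.continuous.comp (continuous_id.sub continuous_const)))

open Classical in
/-- Convolution with an operator-valued kernel `K`, as an operator on `C_b(ℝ, X)`. It is `0` by
convention when `K` is not integrable. -/
noncomputable def convOp (K : ℝ → X →L[ℂ] X) : (ℝ →ᵇ X) →L[ℂ] (ℝ →ᵇ X) :=
  if hK : Integrable K then
    LinearMap.mkContinuous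
      { toFun := fun x => .ofNormedAddCommGroup (fun t => ∫ s, K s (x (t - s)))
          (continuous_integral_kernel hK x) _ (norm_integral_kernel_le hK x)
        map_add' := fun x y => by
          ext t
          simp only [BoundedContinuousFunction.coe_ofNormedAddCommGroup,
            BoundedContinuousFunction.coe_add, Pi.add_apply, map_add]
          exact integral_add (integrable_kernel_apply hK x t) (integrable_kernel_apply hK y t)
        map_smul' := fun c x => by
          ext t
          simp only [BoundedContinuousFunction.coe_ofNormedAddCommGroup,
            BoundedContinuousFunction.coe_smul, map_smul, RingHom.id_apply]
          exact integral_smul c _ }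
      (∫ s, ‖K s‖)
      (fun x => BoundedContinuousFunction.norm_ofNormedAddCommGroup_le _ (by positivity)
        (norm_integral_kernel_le hK x))
  else 0

theorem convOp_apply {K : ℝ → X →L[ℂ] X} (hK : Integrable K) (x : ℝ →ᵇ X) (t : ℝ) :
    convOp K x t = ∫ s, K s (x (t - s)) := by
  rw [convOp, dif_pos hK]
  rfl

theorem norm_convOp_le (K : ℝ → X →L[ℂ] X) (x : ℝ →ᵇ X) :
    ‖convOp K x‖ ≤ (∫ s, ‖K s‖) * ‖x‖ := by
  refine ContinuousLinearMap.le_of_opNorm_le _ ?_ x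
  rw [convOp]
  split_ifs
  · exact LinearMap.mkContinuous_norm_le _ (by positivity) _
  · rw [norm_zero]
    positivity

theorem convOp_sum {ι : Type*} (s : Finset ι) {K : ι → ℝ → X →L[ℂ] X}
    (hK : ∀ i ∈ s, Integrable (K i)) (x : ℝ →ᵇ X) :
    convOp (fun r => ∑ i ∈ s, K i r) x = ∑ i ∈ s, convOp (K i) x := by
  have hsum : Integrable fun r => ∑ i ∈ s, K i r := integrable_finsetSum (f := K) s hK
  ext t
  calc convOp (fun r => ∑ i ∈ s, K i r) x t
      = ∫ r, ∑ i ∈ s, K i r (x (t - r)) := by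
        simp only [convOp_apply hsum, _root_.sum_apply]
    _ = ∑ i ∈ s, ∫ r, K i r (x (t - r)) :=
        integral_finsetSum s fun i hi => integrable_kernel_apply (hK i hi) x t
    _ = (∑ i ∈ s, convOp (K i) x) t := by
        rw [BoundedContinuousFunction.coe_sum, Finset.sum_apply]
        exact Finset.sum_congr rfl fun i hi => (convOp_apply (hK i hi) x t).symm

/-- The convolution of two operator-valued kernels, the kernel of the product of the
convolution operators. -/
noncomputable def kerConv (K J : ℝ → X →L[ℂ] X) (u : ℝ) : X →L[ℂ] X := ∫ s, K s * J (u - s)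

theorem integrable_kerConv_integrand {K J : ℝ → X →L[ℂ] X} (hK : Integrable K)
    (hJ : Integrable J) :
    Integrable (fun p : ℝ × ℝ => K p.2 * J (p.1 - p.2)) (volume.prod volume) :=
  hK.convolution_integrand (ContinuousLinearMap.mul ℂ (X →L[ℂ] X)) hJ

theorem integrable_kerConv {K J : ℝ → X →L[ℂ] X} (hK : Integrable K) (hJ : Integrable J) :
    Integrable (kerConv K J) :=
  hK.integrable_convolution (ContinuousLinearMap.mul ℂ (X →L[ℂ] X)) hJ

theorem integrable_kerConv_integrand_apply {K J : ℝ → X →L[ℂ] X} (hK : Integrable K)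
    (hJ : Integrable J) (x : ℝ →ᵇ X) (t : ℝ) :
    Integrable (Function.uncurry fun s u : ℝ => (K s * J (u - s)) (x (t - u)))
      (volume.prod volume) := by
  have hKJ := integrable_kerConv_integrand hK hJ
  have hswap : Integrable (fun p : ℝ × ℝ => (K p.2 * J (p.1 - p.2)) (x (t - p.1)))
      (volume.prod volume) :=
    (hKJ.norm.mul_const ‖x‖).mono'
      ((ContinuousLinearMap.id ℂ (X →L[ℂ] X)).aestronglyMeasurable_comp₂ hKJ.1
        (x.continuous.comp (continuous_const.sub continuous_fst)).aestronglyMeasurable)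
      (ae_of_all _ fun p => ContinuousLinearMap.le_opNorm_of_le _ (x.norm_coe_le_norm _))
  exact hswap.swap

theorem convOp_convOp [CompleteSpace X] {K J : ℝ → X →L[ℂ] X} (hK : Integrable K)
    (hJ : Integrable J) (x : ℝ →ᵇ X) : convOp K (convOp J x) = convOp (kerConv K J) x := by
  ext t
  calc convOp K (convOp J x) t
      = ∫ s, ∫ u, (K s * J (u - s)) (x (t - u)) := by
        rw [convOp_apply hK]
        congr! 2 with s
        rw [convOp_apply hJ, ← integral_sub_right_eq_self (fun r => J r (x (t - s - r))) s,
          ← ContinuousLinearMap.integral_comp_comm _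
            ((integrable_kernel_apply hJ x (t - s)).comp_sub_right s)]
        congr! 2 with u
        rw [mul_apply_eq_comp, sub_sub_sub_cancel_right]
    _ = ∫ u, ∫ s, (K s * J (u - s)) (x (t - u)) :=
        integral_integral_swap (integrable_kerConv_integrand_apply hK hJ x t)
    _ = convOp (kerConv K J) x t := by
        rw [convOp_apply (integrable_kerConv hK hJ)]
        refine integral_congr_ae ?_
        filter_upwards [(integrable_kerConv_integrand hK hJ).prod_right_ae] with u hu
        rw [kerConv, ContinuousLinearMap.integral_apply hu]

theorem convOp_comm [CompleteSpace X] {K J : ℝ → X →L[ℂ] X} (hK : Integrable K)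
    (hJ : Integrable J) (h : ∀ s r, Commute (K s) (J r)) (x : ℝ →ᵇ X) :
    convOp K (convOp J x) = convOp J (convOp K x) := by
  rw [convOp_convOp hK hJ, convOp_convOp hJ hK]
  congr 2 with u : 1
  rw [kerConv, kerConv, ← integral_sub_left_eq_self _ _ u]
  congr! 2 with _
  rw [(h _ _).eq, sub_sub_cancel]

/-- The operator `x ↦ φ_a * x` on `C_b(ℝ, X)`. -/
noncomputable def phiC (a : ℝ) : (ℝ →ᵇ X) →L[ℂ] (ℝ →ᵇ X) :=
  convOp fun s => phi a s • (1 : X →L[ℂ] X)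

theorem integrable_phi_smul_one (a : ℝ) : Integrable fun s => phi a s • (1 : X →L[ℂ] X) :=
  (integrable_phi a).smul_const _

theorem phiC_apply (a : ℝ) (x : ℝ →ᵇ X) (t : ℝ) : phiC a x t = phiConv a x t := by
  rw [phiC, convOp_apply (integrable_phi_smul_one a), phiConv]
  rfl

theorem phiConvNorm_eq_enorm (a : ℝ) (x : ℝ →ᵇ X) : phiConvNorm a x = ‖phiC a x‖ₑ := by
  rw [BoundedContinuousFunction.enorm_eq_iSup_enorm, phiConvNorm]
  simp only [phiC_apply]

theorem norm_phiC_le (a : ℝ) (x : ℝ →ᵇ X) : ‖phiC a x‖ ≤ phiL1 * ‖x‖ := by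
  refine (norm_convOp_le _ x).trans ?_
  gcongr
  rw [← integral_norm_phi a]
  refine integral_mono (integrable_phi_smul_one a).norm (integrable_phi a).norm fun s => ?_
  rw [norm_smul]
  exact mul_le_of_le_one_right (norm_nonneg _) ContinuousLinearMap.norm_id_le

theorem enorm_phiC_le (a : ℝ) (x : ℝ →ᵇ X) : ‖phiC a x‖ₑ ≤ ENNReal.ofReal phiL1 * ‖x‖ₑ := by
  rw [← ofReal_norm, ← ofReal_norm, ← ENNReal.ofReal_mul phiL1_nonneg]
  exact ENNReal.ofReal_le_ofReal (norm_phiC_le a x)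

theorem convOp_phiC [CompleteSpace X] {K : ℝ → X →L[ℂ] X} (hK : Integrable K) (a : ℝ)
    (x : ℝ →ᵇ X) : convOp K (phiC a x) = phiC a (convOp K x) :=
  convOp_comm hK (integrable_phi_smul_one a)
    (fun _ _ => (Commute.one_right _).smul_right _) x

theorem eq_zero_of_phiC_eq_zero [CompleteSpace X] {x : ℝ →ᵇ X} (h : ∀ a : ℝ, phiC a x = 0) :
    x = 0 := by
  ext t
  set f : ℝ → X := fun s => phi 0 s • x (t - s)
  have hf : Continuous f := (continuous_phi 0).smul (x.continuous.comp (by fun_prop))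
  have hf_int : Integrable f := integrable_kernel_apply (integrable_phi_smul_one 0) x t
  have hinv : angFourierInv f = 0 := by
    ext a
    have ha : ∫ s, phi a s • x (t - s) = 0 := by
      rw [← phiConv, ← phiC_apply, h]
      rfl
    simp only [phi_eq_exp_mul a, mul_smul] at ha
    rw [angFourierInv, Pi.zero_apply, ← smul_zero (1 / (2 * Real.pi) : ℂ), ← ha]
    simp only [f, mul_right_comm]
  have hf0 : f 0 = 0 := by
    rw [← angFourier_angFourierInv hf hf_int (hinv ▸ integrable_zero ..), hinv]
    simp [angFourier]
  simpa [f, phi_zero_zero_ne_zero] using hf0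

end ConvOp

/-! ### Fourier multipliers -/

section Multiplier

variable {X : Type*} [NormedAddCommGroup X] [NormedSpace ℂ X]

/-- The symbols of convolution operators: integrable functions with integrable inverse Fourier
transform. -/
structure IsSymbol (f : ℝ → X →L[ℂ] X) : Prop where
  integrable : Integrable f
  integrable_inv : Integrable (angFourierInv f)

/-- The Fourier multiplier with symbol `f`, an operator on `C_b(ℝ, X)`. -/
noncomputable def multiplier (f : ℝ → X →L[ℂ] X) : (ℝ →ᵇ X) →L[ℂ] (ℝ →ᵇ X) :=
  convOp (angFourierInv f)

theorem multiplier_zero (x : ℝ →ᵇ X) : multiplier (0 : ℝ → X →L[ℂ] X) x = 0 := by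
  have h : angFourierInv (0 : ℝ → X →L[ℂ] X) = 0 := by
    ext
    simp [angFourierInv]
  simpa [multiplier, h] using norm_convOp_le (0 : ℝ → X →L[ℂ] X) x

theorem multiplier_sum {ι : Type*} (s : Finset ι) {f : ι → ℝ → X →L[ℂ] X}
    (hf : ∀ i ∈ s, IsSymbol (f i)) (x : ℝ →ᵇ X) :
    multiplier (fun l => ∑ i ∈ s, f i l) x = ∑ i ∈ s, multiplier (f i) x := by
  simp only [multiplier]
  rw [← convOp_sum s fun i hi => (hf i hi).integrable_inv]
  congr 2 with t : 1
  simp only [angFourierInv, ← Finset.smul_sum]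
  rw [← integral_finsetSum _ fun i hi => integrable_exp_smul (hf i hi).integrable t]
  simp only [Finset.smul_sum]

theorem phi_smul_one_eq_angFourierInv [CompleteSpace X] (a : ℝ) :
    (fun s => phi a s • (1 : X →L[ℂ] X))
      = angFourierInv fun l => (triangle (l - a) : ℂ) • (1 : X →L[ℂ] X) := by
  ext1 s
  simp only [phi_eq_angFourierInv, angFourierInv, ← smul_assoc]
  rw [integral_smul_const, smul_assoc]

theorem isSymbol_triangle_smul_one [CompleteSpace X] (a : ℝ) :
    IsSymbol fun l => (triangle (l - a) : ℂ) • (1 : X →L[ℂ] X) :=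
  ⟨(integrable_triangle_sub a).smul_const _,
    phi_smul_one_eq_angFourierInv (X := X) a ▸ integrable_phi_smul_one a⟩

theorem phiC_eq_multiplier [CompleteSpace X] (a : ℝ) :
    phiC a = multiplier fun l => (triangle (l - a) : ℂ) • (1 : X →L[ℂ] X) := by
  rw [phiC, phi_smul_one_eq_angFourierInv, multiplier]

theorem norm_triangle_le_one (l : ℝ) : ‖(triangle l : ℂ)‖ ≤ 1 := by
  rw [Complex.norm_real, Real.norm_of_nonneg (triangle_nonneg _), triangle_eq_max]
  exact max_le (by linarith [abs_nonneg l]) zero_le_one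

variable [CompleteSpace X]

theorem kerConv_phi_smul_one_angFourierInv (a : ℝ) {f : ℝ → X →L[ℂ] X} (hf : Integrable f) :
    kerConv (fun s => phi a s • (1 : X →L[ℂ] X)) (angFourierInv f)
      = angFourierInv fun l => (triangle (l - a) : ℂ) • f l := by
  ext1 u
  simp only [kerConv, smul_mul_assoc, one_mul]
  simp only [integral_smul_angFourierInv_sub (integrable_phi a) hf, angFourier_phi]

theorem IsSymbol.triangle_smul {f : ℝ → X →L[ℂ] X} (hf : IsSymbol f) (a : ℝ) :
    IsSymbol fun l => (triangle (l - a) : ℂ) • f l where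
  integrable := hf.integrable.bdd_smul 1
    (Continuous.aestronglyMeasurable (by fun_prop)) (ae_of_all _ fun _ => norm_triangle_le_one _)
  integrable_inv := kerConv_phi_smul_one_angFourierInv a hf.integrable ▸
    integrable_kerConv (integrable_phi_smul_one a) hf.integrable_inv

theorem phiC_multiplier {f : ℝ → X →L[ℂ] X} (hf : IsSymbol f) (a : ℝ) (x : ℝ →ᵇ X) :
    phiC a (multiplier f x) = multiplier (fun l => (triangle (l - a) : ℂ) • f l) x := by
  rw [phiC, multiplier, convOp_convOp (integrable_phi_smul_one a) hf.integrable_inv,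
    kerConv_phi_smul_one_angFourierInv a hf.integrable, multiplier]

theorem phiC_phiC (a b : ℝ) (x : ℝ →ᵇ X) : phiC a (phiC b x)
    = multiplier (fun l => (triangle (l - a) : ℂ) • (triangle (l - b) : ℂ) • 1) x := by
  rw [phiC_eq_multiplier b, phiC_multiplier (isSymbol_triangle_smul_one b)]

theorem phiC_phiC_eq_zero {a b : ℝ} (hab : 2 ≤ |a - b|) (x : ℝ →ᵇ X) :
    phiC a (phiC b x) = 0 := by
  rw [phiC_phiC, ← multiplier_zero x]
  congr 2 with l : 1
  rcases le_or_gt 1 |l - a| with ha | ha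
  · rw [triangle_of_one_le ha, Complex.ofReal_zero, zero_smul, Pi.zero_apply]
  · have hb : 1 ≤ |l - b| := by grind
    rw [triangle_of_one_le hb, Complex.ofReal_zero, zero_smul, smul_zero, Pi.zero_apply]

theorem phiC_eq_sum {a b : ℝ} (h1 : b - 1 ≤ a) (h2 : a ≤ b) (x : ℝ →ᵇ X) :
    phiC a x = ∑ j ∈ Finset.range 4, phiC a (phiC (b - 2 + j) x) := by
  simp only [phiC_phiC]
  rw [← multiplier_sum _ fun j _ => (isSymbol_triangle_smul_one _).triangle_smul a,
    phiC_eq_multiplier]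
  congr 2 with l : 1
  rw [← Finset.smul_sum, ← Finset.sum_smul, ← Complex.ofReal_sum]
  rcases le_or_gt 1 |l - a| with hl | hl
  · rw [triangle_of_one_le hl, Complex.ofReal_zero, zero_smul, zero_smul]
  · rw [abs_lt] at hl
    rw [sum_triangle_eq_one (by linarith) (by linarith), Complex.ofReal_one, one_smul]

end Multiplier

/-! ### The Banach space of functions with absolutely summable spectrum -/

section AsNorm

variable {X : Type*} [NormedAddCommGroup X] [NormedSpace ℂ X]

theorem asNorm_eq (x : ℝ →ᵇ X) : asNorm x = ∑' n : ℤ, 5 * ‖phiC (n : ℝ) x‖ₑ := by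
  simp only [asNorm, ENNReal.tsum_mul_left, phiConvNorm_eq_enorm]

theorem asNorm_zero : asNorm (0 : ℝ →ᵇ X) = 0 := by simp [asNorm_eq]

theorem asNorm_add_le (x y : ℝ →ᵇ X) : asNorm (x + y) ≤ asNorm x + asNorm y := by
  simp only [asNorm_eq, ← ENNReal.tsum_add, ← mul_add, map_add]
  gcongr
  exact enorm_add_le _ _

theorem asNorm_smul (c : ℂ) (x : ℝ →ᵇ X) : asNorm (c • x) = ‖c‖ₑ * asNorm x := by
  simp only [asNorm_eq, ← ENNReal.tsum_mul_left, map_smul, enorm_smul, mul_left_comm]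

theorem lowerSemicontinuous_asNorm : LowerSemicontinuous (asNorm : (ℝ →ᵇ X) → ℝ≥0∞) := by
  rw [funext asNorm_eq]
  refine lowerSemicontinuous_tsum fun n => Continuous.lowerSemicontinuous ?_
  exact (ENNReal.continuous_const_mul (by simp)).comp (phiC (n : ℝ)).continuous.enorm

theorem asNorm_le_of_tendsto {ι : Type*} {l : Filter ι} [l.NeBot] {f : ι → ℝ →ᵇ X} {x : ℝ →ᵇ X}
    {C : ℝ≥0∞} (hf : Tendsto f l (𝓝 x)) (h : ∀ᶠ i in l, asNorm (f i) ≤ C) : asNorm x ≤ C :=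
  (lowerSemicontinuous_asNorm.isClosed_preimage C).mem_of_tendsto hf h

theorem asNorm_le_of_phiC_eq_zero {x : ℝ →ᵇ X} (c : ℤ) (r : ℕ)
    (h : ∀ n : ℤ, (r : ℝ) ≤ |(n : ℝ) - c| → phiC (n : ℝ) x = 0) :
    asNorm x ≤ ENNReal.ofReal ((2 * r + 1) * (5 * (phiL1 * ‖x‖))) := by
  have houtside : ∀ n ∉ Finset.Icc (c - r) (c + r), 5 * ‖phiC (n : ℝ) x‖ₑ = 0 := by
    intro n hn
    have : (r : ℤ) ≤ |n - c| := by grind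
    rw [h n (by exact_mod_cast this), enorm_zero, mul_zero]
  have hterm (n : ℤ) : 5 * ‖phiC (n : ℝ) x‖ₑ ≤ ENNReal.ofReal (5 * (phiL1 * ‖x‖)) := by
    rw [ENNReal.ofReal_mul (by norm_num), ENNReal.ofReal_ofNat, ← ofReal_norm]
    gcongr
    exact norm_phiC_le _ _
  have hcard : (Finset.Icc (c - r) (c + r)).card = 2 * r + 1 := by
    rw [Int.card_Icc]
    omega
  rw [asNorm_eq, tsum_eq_sum houtside]
  refine (Finset.sum_le_card_nsmul _ _ _ fun n _ => hterm n).trans_eq ?_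
  rw [hcard, ← ENNReal.ofReal_nsmul, nsmul_eq_mul]
  push_cast
  rfl

theorem lowerSemicontinuous_phiConvNorm (x : ℝ →ᵇ X) :
    LowerSemicontinuous fun a : ℝ => phiConvNorm a x := by
  refine lowerSemicontinuous_iSup fun t => Continuous.lowerSemicontinuous (Continuous.enorm ?_)
  refine continuous_of_dominated (F := fun a s => phi a s • x (t - s))
    (bound := fun s => ‖phi 0 s‖ * ‖x‖)
    (fun a => (integrable_kernel_apply (integrable_phi_smul_one a) x t).1)
    (fun a => ae_of_all _ fun s => ?_) ((integrable_phi 0).norm.mul_const _)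
    (ae_of_all _ fun s => ?_)
  · rw [norm_smul, norm_phi]
    gcongr
    exact x.norm_coe_le_norm _
  · have h : Continuous fun a : ℝ => exp (I * (a : ℂ) * (s : ℂ)) * phi 0 s := by fun_prop
    exact (h.congr fun a => (phi_eq_exp_mul a s).symm).smul continuous_const

theorem lintegral_eq_tsum_Ico (g : ℝ → ℝ≥0∞) :
    ∫⁻ a, g a = ∑' n : ℤ, ∫⁻ a in Set.Ico (n : ℝ) (n + 1), g a := by
  rw [← lintegral_iUnion (fun n => measurableSet_Ico) (Set.pairwise_disjoint_Ico_intCast ℝ),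
    iUnion_Ico_intCast, Measure.restrict_univ]

theorem asNorm_lt_top_iff {x : ℝ →ᵇ X} :
    asNorm x < ∞ ↔ ∑' n : ℤ, phiConvNorm (n : ℝ) x < ∞ := by
  rw [asNorm, ENNReal.mul_lt_top_iff]
  simp +contextual

variable [CompleteSpace X]

theorem phiConvNorm_le {a b : ℝ} (h1 : b - 1 ≤ a) (h2 : a ≤ b) (x : ℝ →ᵇ X) :
    phiConvNorm a x ≤
      ENNReal.ofReal phiL1 * ∑ j ∈ Finset.range 4, phiConvNorm (b - 2 + j) x := by
  simp only [phiConvNorm_eq_enorm]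
  rw [phiC_eq_sum h1 h2, Finset.mul_sum]
  exact (enorm_sum_le _ _).trans (Finset.sum_le_sum fun j _ => enorm_phiC_le _ _)

theorem MemAS.asNorm_lt_top {x : ℝ →ᵇ X} (hx : MemAS x) : asNorm x < ∞ := by
  have hmeas (j : ℕ) : Measurable fun b : ℝ => phiConvNorm (b - 2 + j) x :=
    (lowerSemicontinuous_phiConvNorm x).measurable.comp (by fun_prop)
  have hshift (j : ℕ) : ∫⁻ b : ℝ, phiConvNorm (b - 2 + j) x = ∫⁻ a : ℝ, phiConvNorm a x := by
    rw [← lintegral_add_right_eq_self (fun a => phiConvNorm a x) (-2 + (j : ℝ))]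
    simp only [← add_assoc, ← sub_eq_add_neg]
  rw [asNorm_lt_top_iff]
  calc ∑' n : ℤ, phiConvNorm (n : ℝ) x
      = ∑' n : ℤ, ∫⁻ _ in Set.Ico (n : ℝ) (n + 1), phiConvNorm (n : ℝ) x := by simp
    _ ≤ ∑' n : ℤ, ∫⁻ b in Set.Ico (n : ℝ) (n + 1),
          ENNReal.ofReal phiL1 * ∑ j ∈ Finset.range 4, phiConvNorm (b - 2 + j) x :=
        ENNReal.tsum_le_tsum fun n => setLIntegral_mono' measurableSet_Ico fun b hb =>
          phiConvNorm_le (by linarith [hb.2]) hb.1 x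
    _ = ENNReal.ofReal phiL1 * ∑ j ∈ Finset.range 4, ∫⁻ a : ℝ, phiConvNorm a x := by
        rw [← lintegral_eq_tsum_Ico,
          lintegral_const_mul _ (Finset.measurable_fun_sum _ fun j _ => hmeas j),
          lintegral_finsetSum _ fun j _ => hmeas j]
        simp only [hshift]
    _ < ∞ := ENNReal.mul_lt_top ENNReal.ofReal_lt_top (ENNReal.sum_lt_top.2 fun j _ => hx)

theorem memAS_of_asNorm_lt_top {x : ℝ →ᵇ X} (hx : asNorm x < ∞) : MemAS x := by
  rw [asNorm_lt_top_iff] at hx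
  have hshift (j : ℕ) :
      ∑' n : ℤ, phiConvNorm ((n + 1 : ℝ) - 2 + j) x = ∑' n : ℤ, phiConvNorm (n : ℝ) x := by
    rw [← (Equiv.addRight (-1 + (j : ℤ))).tsum_eq fun n : ℤ => phiConvNorm (n : ℝ) x]
    refine tsum_congr fun n => ?_
    rw [Equiv.coe_addRight]
    congr 1
    push_cast
    ring
  calc ∫⁻ a : ℝ, phiConvNorm a x
      = ∑' n : ℤ, ∫⁻ a in Set.Ico (n : ℝ) (n + 1), phiConvNorm a x := lintegral_eq_tsum_Ico _
    _ ≤ ∑' n : ℤ, ∫⁻ _ in Set.Ico (n : ℝ) (n + 1), ENNReal.ofReal phiL1 *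
          ∑ j ∈ Finset.range 4, phiConvNorm ((n + 1 : ℝ) - 2 + j) x :=
        ENNReal.tsum_le_tsum fun n => setLIntegral_mono' measurableSet_Ico fun a ha =>
          phiConvNorm_le (by linarith [ha.1]) ha.2.le x
    _ = ENNReal.ofReal phiL1 * ∑ _j ∈ Finset.range 4, ∑' n : ℤ, phiConvNorm (n : ℝ) x := by
        simp only [setLIntegral_const, Real.volume_Ico, add_sub_cancel_left, ENNReal.ofReal_one,
          mul_one]
        rw [ENNReal.tsum_mul_left, Summable.tsum_finsetSum fun _ _ => ENNReal.summable]
        simp only [hshift]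
    _ < ∞ := ENNReal.mul_lt_top ENNReal.ofReal_lt_top (ENNReal.sum_lt_top.2 fun j _ => hx)

theorem memAS_iff {x : ℝ →ᵇ X} : MemAS x ↔ asNorm x < ∞ :=
  ⟨MemAS.asNorm_lt_top, memAS_of_asNorm_lt_top⟩

theorem summable_norm_phiC {x : ℝ →ᵇ X} (hx : MemAS x) :
    Summable fun n : ℤ => ‖phiC (n : ℝ) x‖ := by
  have h := asNorm_lt_top_iff.1 hx.asNorm_lt_top
  simp only [phiConvNorm_eq_enorm] at h
  exact NNReal.summable_coe.2 (ENNReal.tsum_coe_ne_top_iff_summable.1 h.ne)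

theorem hasSum_phiC_phiC (a : ℝ) (x : ℝ →ᵇ X) :
    HasSum (fun n : ℤ => phiC a (phiC (n : ℝ) x)) (phiC a x) := by
  set s := (Finset.range 4).map (Nat.castEmbedding.trans (addLeftEmbedding (⌊a⌋ - 1)))
  have hsum : phiC a x = ∑ n ∈ s, phiC a (phiC (n : ℝ) x) := by
    rw [Finset.sum_map, phiC_eq_sum (b := (⌊a⌋ : ℝ) + 1) (by linarith [Int.floor_le a])
      (Int.lt_floor_add_one a).le]
    refine Finset.sum_congr rfl fun j _ => ?_
    congr 2
    simp only [Function.Embedding.trans_apply, Nat.castEmbedding_apply, addLeftEmbedding_apply]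
    push_cast
    ring_nf
  rw [hsum]
  refine hasSum_sum_of_ne_finset_zero fun n hn => phiC_phiC_eq_zero ?_ x
  have hn' : n ≤ ⌊a⌋ - 2 ∨ ⌊a⌋ + 3 ≤ n := by
    by_contra! hc
    refine hn (Finset.mem_map.2 ⟨(n - (⌊a⌋ - 1)).toNat, Finset.mem_range.2 (by omega), ?_⟩)
    simp only [Function.Embedding.trans_apply, Nat.castEmbedding_apply, addLeftEmbedding_apply]
    omega
  rcases hn' with h | h
  · have : (n : ℝ) ≤ ⌊a⌋ - 2 := by exact_mod_cast h
    exact le_abs.2 (Or.inl (by linarith [Int.floor_le a]))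
  · have : (⌊a⌋ : ℝ) + 3 ≤ n := by exact_mod_cast h
    exact le_abs.2 (Or.inr (by linarith [Int.lt_floor_add_one a]))

theorem hasSum_phiC {x : ℝ →ᵇ X} (hx : MemAS x) :
    HasSum (fun n : ℤ => phiC (n : ℝ) x) x := by
  obtain ⟨y, hy⟩ := (summable_norm_phiC hx).of_norm
  have hxy : x - y = 0 := eq_zero_of_phiC_eq_zero fun a => by
    rw [map_sub, (hasSum_phiC_phiC a x).unique ((phiC a).hasSum hy), sub_self]
  exact (sub_eq_zero.1 hxy).symm ▸ hy

theorem enorm_le_asNorm (x : ℝ →ᵇ X) : ‖x‖ₑ ≤ asNorm x := by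
  by_cases hx : MemAS x
  · rw [asNorm_eq, ENNReal.tsum_mul_left]
    nth_rw 1 [← (hasSum_phiC hx).tsum_eq]
    exact enorm_tsum_le_tsum_enorm.trans (le_mul_of_one_le_left' (by norm_num))
  · rw [memAS_iff, not_lt, top_le_iff] at hx
    exact hx ▸ le_top

end AsNorm

section ASpace

variable (X : Type*) [NormedAddCommGroup X] [NormedSpace ℂ X] [CompleteSpace X]

/-- The linear subspace `F_as` of `C_b(ℝ, X)`. -/
def asSubmodule : Submodule ℂ (ℝ →ᵇ X) where
  carrier := {x | MemAS x}
  add_mem' {x y} hx hy := memAS_iff.2 <| (asNorm_add_le x y).trans_lt <|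
    ENNReal.add_lt_top.2 ⟨hx.asNorm_lt_top, hy.asNorm_lt_top⟩
  zero_mem' := memAS_iff.2 (asNorm_zero.trans_lt ENNReal.zero_lt_top)
  smul_mem' c x hx := memAS_iff.2 <| (asNorm_smul c x).trans_lt <|
    ENNReal.mul_lt_top enorm_lt_top hx.asNorm_lt_top

/-- The space `F_as` with the norm `‖·‖_as`: a type synonym of the subspace `asSubmodule X`, which
would carry the supremum norm. -/
def ASpace : Type _ := asSubmodule X

namespace ASpace

noncomputable instance : AddCommGroup (ASpace X) := inferInstanceAs (AddCommGroup (asSubmodule X))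

noncomputable instance : Module ℂ (ASpace X) := inferInstanceAs (Module ℂ (asSubmodule X))

/-- The inclusion of `F_as` into `C_b(ℝ, X)`. -/
noncomputable def incl : ASpace X →ₗ[ℂ] (ℝ →ᵇ X) := (asSubmodule X).subtype

variable {X}

theorem incl_injective : Function.Injective (incl X) := Subtype.val_injective

theorem memAS_incl (x : ASpace X) : MemAS (incl X x) := x.2

theorem exists_incl_eq {x : ℝ →ᵇ X} (hx : MemAS x) : ∃ u : ASpace X, incl X u = x := ⟨⟨x, hx⟩, rfl⟩

noncomputable instance : Norm (ASpace X) := ⟨fun x => (asNorm (incl X x)).toReal⟩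

theorem asNorm_incl (x : ASpace X) : asNorm (incl X x) = ENNReal.ofReal ‖x‖ :=
  (ENNReal.ofReal_toReal (memAS_incl x).asNorm_lt_top.ne).symm

theorem norm_le_iff {x : ASpace X} {C : ℝ} (hC : 0 ≤ C) :
    ‖x‖ ≤ C ↔ asNorm (incl X x) ≤ ENNReal.ofReal C := by
  rw [asNorm_incl, ENNReal.ofReal_le_ofReal_iff hC]

theorem norm_incl_le (x : ASpace X) : ‖incl X x‖ ≤ ‖x‖ := by
  have h := enorm_le_asNorm (incl X x)
  rw [asNorm_incl, ← ofReal_norm] at h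
  exact (ENNReal.ofReal_le_ofReal_iff ENNReal.toReal_nonneg).1 h

theorem sum_norm_phiC_le (x : ASpace X) (s : Finset ℤ) :
    ∑ n ∈ s, ‖phiC (n : ℝ) (incl X x)‖ ≤ ‖x‖ := by
  refine (ENNReal.ofReal_le_ofReal_iff ENNReal.toReal_nonneg).1 ?_
  rw [ENNReal.ofReal_sum_of_nonneg fun _ _ => norm_nonneg _]
  refine le_trans ?_ (asNorm_incl x).le
  rw [asNorm_eq]
  simp only [ofReal_norm]
  exact (Finset.sum_le_sum fun n _ => le_mul_of_one_le_left' (by norm_num)).trans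
    (ENNReal.sum_le_tsum s)

theorem normedSpaceCore : NormedSpace.Core ℂ (ASpace X) where
  norm_nonneg _ := ENNReal.toReal_nonneg
  norm_smul c x := by
    change (asNorm (incl X (c • x))).toReal = _
    rw [map_smul, asNorm_smul, ENNReal.toReal_mul, toReal_enorm]
    rfl
  norm_triangle x y := by
    refine (norm_le_iff (add_nonneg ENNReal.toReal_nonneg ENNReal.toReal_nonneg)).2 ?_
    rw [map_add, ENNReal.ofReal_add ENNReal.toReal_nonneg ENNReal.toReal_nonneg]
    exact (asNorm_add_le _ _).trans_eq (congr_arg₂ _ (asNorm_incl x) (asNorm_incl y))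
  norm_eq_zero_iff x := by
    refine ⟨fun h => incl_injective ?_, fun h => ?_⟩
    · rw [map_zero, ← norm_le_zero_iff, ← h]
      exact norm_incl_le x
    · change (asNorm (incl X x)).toReal = 0
      rw [h, map_zero, asNorm_zero, ENNReal.toReal_zero]

noncomputable instance : NormedAddCommGroup (ASpace X) := .ofCore normedSpaceCore

noncomputable instance : NormedSpace ℂ (ASpace X) := .ofCore normedSpaceCore

/-- The inclusion of `F_as` into `C_b(ℝ, X)`, as a bounded operator. -/
noncomputable def inclL : ASpace X →L[ℂ] (ℝ →ᵇ X) :=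
  (incl X).mkContinuous 1 fun x => (norm_incl_le x).trans_eq (one_mul _).symm

instance : CompleteSpace (ASpace X) := by
  refine Metric.complete_of_cauchySeq_tendsto fun u hu => ?_
  obtain ⟨x, hx⟩ := cauchySeq_tendsto_of_complete
    ((inclL (X := X)).uniformContinuous.comp_cauchySeq hu)
  have hclose (ε : ℝ) (hε : 0 < ε) : ∀ᶠ n in atTop, asNorm (incl X (u n) - x) ≤ .ofReal ε := by
    obtain ⟨N, hN⟩ := Metric.cauchySeq_iff.1 hu ε hε
    filter_upwards [eventually_ge_atTop N] with n hn
    refine asNorm_le_of_tendsto (hx.const_sub (incl X (u n))) ?_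
    filter_upwards [eventually_ge_atTop N] with m hm
    have := (hN n hn m hm).le
    rwa [dist_eq_norm, norm_le_iff hε.le, map_sub] at this
  obtain ⟨N, hN⟩ := (hclose 1 one_pos).exists
  obtain ⟨d, hd⟩ := exists_incl_eq (memAS_of_asNorm_lt_top (hN.trans_lt ENNReal.ofReal_lt_top))
  refine ⟨u N - d, tendsto_iff_norm_sub_tendsto_zero.2 <|
    tendsto_order.2 ⟨fun a ha => .of_forall fun n => ha.trans_le (norm_nonneg _), fun a ha => ?_⟩⟩
  filter_upwards [hclose (a / 2) (half_pos ha)] with n hn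
  refine ((norm_le_iff (half_pos ha).le).2 ?_).trans_lt (half_lt_self ha)
  rwa [map_sub, map_sub, hd, sub_sub_cancel]

end ASpace

end ASpace

/-! ### Polynomial superposition operators -/

section Superposition

variable {X : Type*} [NormedAddCommGroup X] [NormedSpace ℂ X]

/-- The superposition operator `(x₁, …, x_k) ↦ M(x₁(·), …, x_k(·))` of a bounded multilinear map
`M`, on `C_b(ℝ, X)`. -/
noncomputable def superposition {k : ℕ} (M : ContinuousMultilinearMap ℂ (fun _ : Fin k => X) X) :
    ContinuousMultilinearMap ℂ (fun _ : Fin k => ℝ →ᵇ X) (ℝ →ᵇ X) :=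
  MultilinearMap.mkContinuous
    { toFun := fun x => .ofNormedAddCommGroup (fun t => M fun i => x i t)
        (M.cont.comp (continuous_pi fun i => (x i).continuous)) (‖M‖ * ∏ i, ‖x i‖)
        (fun t => M.le_opNorm_mul_prod_of_le fun i => (x i).norm_coe_le_norm t)
      map_update_add' := fun {dec} x i y z => by
        ext t
        have h (w : ℝ →ᵇ X) : (fun j => Function.update x i w j t)
            = Function.update (fun j => x j t) i (w t) := by
          grind [Function.update_apply]
        simp [h]
      map_update_smul' := fun {dec} x i c y => by
        ext t
        have h (w : ℝ →ᵇ X) : (fun j => Function.update x i w j t)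
            = Function.update (fun j => x j t) i (w t) := by
          grind [Function.update_apply]
        simp [h] }
    ‖M‖ fun x => BoundedContinuousFunction.norm_ofNormedAddCommGroup_le _ (by positivity)
      fun t => M.le_opNorm_mul_prod_of_le fun i => (x i).norm_coe_le_norm t

theorem superposition_apply {k : ℕ} (M : ContinuousMultilinearMap ℂ (fun _ : Fin k => X) X)
    (x : Fin k → ℝ →ᵇ X) (t : ℝ) : superposition M x t = M fun i => x i t := rfl

theorem norm_superposition_le {k : ℕ} (M : ContinuousMultilinearMap ℂ (fun _ : Fin k => X) X) :
    ‖superposition M‖ ≤ ‖M‖ :=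
  MultilinearMap.mkContinuous_norm_le _ (norm_nonneg M) _

theorem polyComp_eq_sum (n : ℕ)
    (F : (k : ℕ) → ContinuousMultilinearMap ℂ (fun _ : Fin k => X) X) (x : ℝ →ᵇ X) :
    polyComp n F x = ∑ k ∈ Finset.Icc 1 n, superposition (F k) fun _ => x := by
  ext t
  simp [polyComp, poly, superposition_apply]

theorem angFourier_mul_phi_sub {h : ℝ → ℂ} (hh : Integrable h) (c u l : ℝ) :
    angFourier (fun s => h s * phi c (u - s)) l
      = angFourierInv (fun l' => angFourier h (l + l') * (triangle (l' - c) : ℂ)) u := by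
  have hint : Integrable fun s : ℝ => exp (-(I * l * s)) • h s := by
    refine (integrable_exp_smul hh (-l)).congr (ae_of_all _ fun s => ?_)
    simp only [Complex.ofReal_neg, mul_neg, mul_right_comm]
  have hconv := integral_smul_angFourierInv_sub hint (integrable_triangle_sub c) u
  rw [← phi_eq_angFourierInv] at hconv
  rw [angFourier]
  simp only [smul_eq_mul, ← mul_assoc] at hconv ⊢
  rw [hconv]
  congr 1 with l'
  simp only [angFourier, smul_eq_mul, ← mul_assoc, ← Complex.exp_add]
  congr! 5
  push_cast
  ring

theorem norm_phi_le (a t : ℝ) : ‖phi a t‖ ≤ ∫ l, ‖(triangle (l - a) : ℂ)‖ :=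
  phi_eq_angFourierInv a ▸ norm_angFourierInv_le _ t

variable [CompleteSpace X]

theorem map_phiC_sub_eq_integral {Y : Type*} [NormedAddCommGroup Y] [NormedSpace ℂ Y]
    [CompleteSpace Y] (N : X →L[ℂ] Y) (c : ℝ) (g : ℝ →ᵇ X) (t s : ℝ) :
    N (phiC c g (t - s)) = ∫ u, phi c (u - s) • N (g (t - u)) := by
  have hint := integrable_kernel_apply (integrable_phi_smul_one c) g (t - s)
  simp only [_root_.smul_apply, one_apply_eq_self] at hint
  rw [phiC_apply, phiConv, ← N.integral_comp_comm hint,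
    ← integral_sub_right_eq_self (fun r => N (phi c r • g (t - s - r))) s]
  simp only [map_smul, sub_sub_sub_cancel_right]

theorem integral_smul_map_phiC_sub {h : ℝ → ℂ} (hh : Integrable h) {N : ℝ → X →L[ℂ] X}
    (hN : Continuous fun p : ℝ × X => N p.1 p.2) {C : ℝ} (hC : ∀ s, ‖N s‖ ≤ C) (c : ℝ)
    (g : ℝ →ᵇ X) (t : ℝ) :
    ∫ s, h s • N s (phiC c g (t - s))
      = ∫ u, ∫ s, (h s * phi c (u - s)) • N s (g (t - u)) := by
  have hkernel : Integrable (fun p : ℝ × ℝ => h p.1 * phi c (p.2 - p.1)) (volume.prod volume) :=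
    (hh.convolution_integrand (ContinuousLinearMap.mul ℂ ℂ) (integrable_phi c)).swap
  have hint : Integrable (Function.uncurry fun s u : ℝ =>
      (h s * phi c (u - s)) • N s (g (t - u))) (volume.prod volume) := by
    refine hkernel.smul_bdd (f := fun p : ℝ × ℝ => N p.1 (g (t - p.2))) (C * ‖g‖) ?_
      (ae_of_all _ fun p => ?_)
    · exact (hN.comp (continuous_fst.prodMk
        (g.continuous.comp (continuous_const.sub continuous_snd)))).aestronglyMeasurable
    · exact (N p.1).le_of_opNorm_le_of_le (hC _) (g.norm_coe_le_norm _)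
  rw [← integral_integral_swap hint]
  congr! 2 with s
  rw [map_phiC_sub_eq_integral, ← integral_smul]
  simp only [mul_smul]

/-- The inductive form of the fact that the spectrum of a product lies in the sum of the spectra:
a test function whose transform vanishes on the sum of the bands annihilates the product. -/
theorem integral_smul_superposition_eq_zero {k : ℕ}
    (M : ContinuousMultilinearMap ℂ (fun _ : Fin k => X) X) (c : Fin k → ℝ) (g : Fin k → ℝ →ᵇ X)
    {h : ℝ → ℂ} (hh : Integrable h) (hvanish : ∀ l, |l - ∑ i, c i| ≤ k → angFourier h l = 0)
    (t : ℝ) : ∫ s, h s • superposition M (fun i => phiC (c i) (g i)) (t - s) = 0 := by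
  induction k generalizing h with
  | zero =>
    have h0 : ∫ s, h s = 0 := by simpa [angFourier] using hvanish 0 (by simp)
    simp only [superposition_apply, Subsingleton.elim (fun _ : Fin 0 => _) Fin.elim0]
    rw [integral_smul_const, h0, zero_smul]
  | succ k ih =>
    set y : Fin k → ℝ →ᵇ X := fun i => phiC (c i.succ) (g i.succ)
    set N : ℝ → X →L[ℂ] X := fun s =>
      (ContinuousMultilinearMap.apply ℂ (fun _ : Fin k => X) X fun i => y i (t - s)).comp
        M.curryLeft
    have hN_apply (s : ℝ) (v : X) : N s v = superposition (M.curryLeft v) y (t - s) := rfl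
    have hN_cont : Continuous fun p : ℝ × X => N p.1 p.2 :=
      M.cont.comp (.finCons continuous_snd (continuous_pi fun i => (y i).continuous.comp
        (continuous_const.sub continuous_fst)))
    have hN_le (s : ℝ) : ‖N s‖ ≤ ‖M‖ * ∏ i, ‖y i‖ := by
      refine ContinuousLinearMap.opNorm_le_bound _ (by positivity) fun v => ?_
      rw [mul_right_comm, ← M.curryLeft_norm]
      exact ContinuousMultilinearMap.le_mul_prod_of_opNorm_le_of_le
        (M.curryLeft.le_opNorm v) fun i => (y i).norm_coe_le_norm _
    have hsplit (s : ℝ) : superposition M (fun i => phiC (c i) (g i)) (t - s)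
        = N s (phiC (c 0) (g 0) (t - s)) := by
      rw [superposition_apply]
      exact congrArg M (funext fun i => Fin.cases rfl (fun _ => rfl) i)
    simp only [hsplit]
    rw [integral_smul_map_phiC_sub hh hN_cont hN_le]
    simp only [hN_apply]
    refine integral_eq_zero_of_ae (ae_of_all _ fun u =>
      ih (M.curryLeft (g 0 (t - u))) (fun i => c i.succ) (fun i => g i.succ) ?_ fun l hl => ?_)
    · exact hh.mul_bdd ((continuous_phi _).comp (by fun_prop)).aestronglyMeasurable
        (ae_of_all _ fun s => norm_phi_le _ _)
    · have hzero (l' : ℝ) : angFourier h (l + l') * (triangle (l' - c 0) : ℂ) = 0 := by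
        rcases le_or_gt 1 |l' - c 0| with h1 | h1
        · rw [triangle_of_one_le h1, Complex.ofReal_zero, mul_zero]
        · rw [hvanish, zero_mul]
          rw [Fin.sum_univ_succ, add_comm (c 0), add_sub_add_comm]
          push_cast
          exact (abs_add_le _ _).trans (add_le_add hl h1.le)
      simp [angFourier_mul_phi_sub hh, hzero, angFourierInv]

theorem phiC_superposition_eq_zero {k : ℕ}
    (M : ContinuousMultilinearMap ℂ (fun _ : Fin k => X) X) (c : Fin k → ℝ) (g : Fin k → ℝ →ᵇ X)
    {a : ℝ} (ha : (k + 1 : ℝ) ≤ |a - ∑ i, c i|) :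
    phiC a (superposition M fun i => phiC (c i) (g i)) = 0 := by
  ext t
  rw [phiC_apply]
  refine integral_smul_superposition_eq_zero M c g (integrable_phi a) (fun l hl => ?_) t
  rw [angFourier_phi, triangle_of_one_le, Complex.ofReal_zero]
  linarith [abs_sub_le a l (∑ i, c i), abs_sub_comm a l]

theorem asNorm_superposition_phiC_le {k : ℕ}
    (M : ContinuousMultilinearMap ℂ (fun _ : Fin k => X) X) (c : Fin k → ℤ) (g : Fin k → ℝ →ᵇ X) :
    asNorm (superposition M fun i => phiC (c i : ℝ) (g i)) ≤ ENNReal.ofReal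
      ((2 * (k + 1 : ℕ) + 1) * (5 * (phiL1 * (‖M‖ * ∏ i, ‖phiC (c i : ℝ) (g i)‖)))) := by
  refine (asNorm_le_of_phiC_eq_zero (∑ i, c i) (k + 1) fun n hn =>
    phiC_superposition_eq_zero M _ g (by exact_mod_cast hn)).trans ?_
  gcongr
  · exact phiL1_nonneg
  · exact ContinuousMultilinearMap.le_of_opNorm_le (norm_superposition_le M) _

end Superposition

namespace ASpace

variable {X : Type*} [NormedAddCommGroup X] [NormedSpace ℂ X] [CompleteSpace X]

theorem asNorm_superposition_le {k : ℕ} (M : ContinuousMultilinearMap ℂ (fun _ : Fin k => X) X)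
    (x : Fin k → ASpace X) :
    asNorm (superposition M fun i => incl X (x i)) ≤
      ENNReal.ofReal ((2 * (k + 1 : ℕ) + 1) * (5 * (phiL1 * (‖M‖ * ∏ i, ‖x i‖)))) := by
  have hlim : Tendsto
      (fun s : Finset ℤ => superposition M fun i => ∑ n ∈ s, phiC (n : ℝ) (incl X (x i)))
      atTop (𝓝 (superposition M fun i => incl X (x i))) :=
    ((superposition M).cont.tendsto _).comp
      (tendsto_pi_nhds.2 fun i => hasSum_phiC (memAS_incl (x i)))
  refine asNorm_le_of_tendsto hlim (.of_forall fun s => ?_)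
  have hphi := phiL1_nonneg
  calc asNorm (superposition M fun i => ∑ n ∈ s, phiC (n : ℝ) (incl X (x i)))
      = asNorm (∑ r ∈ Fintype.piFinset fun _ : Fin k => s,
          superposition M fun i => phiC (r i : ℝ) (incl X (x i))) := by
        rw [ContinuousMultilinearMap.map_sum_finset]
    _ ≤ ∑ r ∈ Fintype.piFinset fun _ : Fin k => s, ENNReal.ofReal ((2 * (k + 1 : ℕ) + 1) *
          (5 * (phiL1 * (‖M‖ * ∏ i, ‖phiC (r i : ℝ) (incl X (x i))‖)))) :=
        (Finset.le_sum_of_subadditive _ asNorm_zero.le asNorm_add_le _ _).trans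
          (Finset.sum_le_sum fun r _ => asNorm_superposition_phiC_le M r _)
    _ = ENNReal.ofReal ((2 * (k + 1 : ℕ) + 1) *
          (5 * (phiL1 * (‖M‖ * ∏ i, ∑ n ∈ s, ‖phiC (n : ℝ) (incl X (x i))‖)))) := by
        rw [← ENNReal.ofReal_sum_of_nonneg fun _ _ => by positivity, Finset.prod_univ_sum]
        simp only [Finset.mul_sum]
    _ ≤ _ := by
        gcongr with i
        exact sum_norm_phiC_le (x i) s

/-- The superposition operator of `M` on `F_as`. -/
noncomputable def superpositionAS {k : ℕ}
    (M : ContinuousMultilinearMap ℂ (fun _ : Fin k => X) X) :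
    ContinuousMultilinearMap ℂ (fun _ : Fin k => ASpace X) (ASpace X) :=
  MultilinearMap.mkContinuous (E := fun _ : Fin k => ASpace X) (G := ASpace X)
    (((superposition M).toMultilinearMap.compLinearMap fun _ => incl X).codRestrict
      (asSubmodule X) fun x => memAS_of_asNorm_lt_top <|
        (asNorm_superposition_le M x).trans_lt ENNReal.ofReal_lt_top)
    ((2 * (k + 1 : ℕ) + 1) * (5 * (phiL1 * ‖M‖))) fun x => by
      have hphi := phiL1_nonneg
      simp only [mul_assoc]
      exact (norm_le_iff (by positivity)).2 (asNorm_superposition_le M x)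

/-- The operator `x ↦ F(x(·))` on `F_as`. -/
noncomputable def polyCompAS (n : ℕ)
    (F : (k : ℕ) → ContinuousMultilinearMap ℂ (fun _ : Fin k => X) X) (x : ASpace X) : ASpace X :=
  ∑ k ∈ Finset.Icc 1 n, superpositionAS (F k) fun _ => x

theorem incl_polyCompAS (n : ℕ)
    (F : (k : ℕ) → ContinuousMultilinearMap ℂ (fun _ : Fin k => X) X) (x : ASpace X) :
    incl X (polyCompAS n F x) = polyComp n F (incl X x) := by
  rw [polyCompAS, map_sum, polyComp_eq_sum]
  rfl

theorem continuous_polyCompAS (n : ℕ)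
    (F : (k : ℕ) → ContinuousMultilinearMap ℂ (fun _ : Fin k => X) X) :
    Continuous (polyCompAS n F) :=
  continuous_finsetSum _ fun k _ => (superpositionAS (F k)).cont.comp (by fun_prop)

end ASpace

/-! ### The semigroup and the resolvent on the imaginary axis -/

section Semigroup

variable {X : Type*} [NormedAddCommGroup X] [NormedSpace ℂ X] {T : ℝ≥0 → X →L[ℂ] X}

namespace IsC0Semigroup

theorem exists_bound [CompleteSpace X] (hT : IsC0Semigroup T) (r : ℝ≥0) :
    ∃ C : ℝ, 0 ≤ C ∧ ∀ s ≤ r, ‖T s‖ ≤ C := by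
  obtain ⟨C, hC⟩ := banach_steinhaus (g := fun s : Set.Icc (0 : ℝ≥0) r => T s) fun v => by
    obtain ⟨C, hC⟩ := (isCompact_Icc (a := (0 : ℝ≥0)) (b := r)).exists_bound_of_continuousOn
      (hT.strongly_continuous v).continuousOn
    exact ⟨C, fun s => hC s s.2⟩
  exact ⟨C, (norm_nonneg _).trans (hC ⟨0, by simp⟩), fun s hs => hC ⟨s, zero_le, hs⟩⟩

theorem continuous_uncurry [CompleteSpace X] (hT : IsC0Semigroup T) :
    Continuous fun p : ℝ≥0 × X => T p.1 p.2 := by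
  rw [continuous_iff_continuousAt]
  rintro ⟨s₀, v₀⟩
  obtain ⟨C, -, hC⟩ := hT.exists_bound (s₀ + 1)
  have hdist : ∀ᶠ p : ℝ≥0 × X in 𝓝 (s₀, v₀),
      ‖T p.1 p.2 - T s₀ v₀‖ ≤ C * ‖p.2 - v₀‖ + ‖T p.1 v₀ - T s₀ v₀‖ := by
    have hfst : ∀ᶠ p : ℝ≥0 × X in 𝓝 (s₀, v₀), p.1 < s₀ + 1 :=
      continuous_fst.continuousAt.eventually_lt continuousAt_const (by simp)
    filter_upwards [hfst] with p hp
    rw [← sub_add_sub_cancel (T p.1 p.2) (T p.1 v₀), ← map_sub]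
    exact norm_add_le_of_le ((T p.1).le_of_opNorm_le (hC _ hp.le) _) le_rfl
  have hcont : Continuous fun p : ℝ≥0 × X => C * ‖p.2 - v₀‖ + ‖T p.1 v₀ - T s₀ v₀‖ := by
    have hT₀ : Continuous fun p : ℝ≥0 × X => T p.1 v₀ :=
      (hT.strongly_continuous v₀).comp continuous_fst
    exact (continuous_const.mul (continuous_snd.sub continuous_const).norm).add
      (hT₀.sub continuous_const).norm
  rw [ContinuousAt, tendsto_iff_norm_sub_tendsto_zero]
  exact squeeze_zero' (.of_forall fun _ => norm_nonneg _) hdist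
    (by simpa using hcont.tendsto (s₀, v₀))

theorem continuous_apply [CompleteSpace X] {α : Type*} [TopologicalSpace α]
    (hT : IsC0Semigroup T) {f : α → ℝ} {g : α → X} (hf : Continuous f) (hg : Continuous g) :
    Continuous fun a => T (f a).toNNReal (g a) :=
  hT.continuous_uncurry.comp ((continuous_real_toNNReal.comp hf).prodMk hg)

theorem apply_apply (hT : IsC0Semigroup T) (s t : ℝ≥0) (v : X) : T s (T t v) = T (s + t) v := by
  rw [hT.map_add]
  rfl

end IsC0Semigroup

theorem hasGenerator_generator (v : (generator T).domain) : HasGenerator T v (generator T v) :=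
  Classical.choose_spec v.2

theorem HasGenerator.semigroup_apply (hT : IsC0Semigroup T) {v w : X} (h : HasGenerator T v w)
    (r : ℝ≥0) : HasGenerator T (T r v) (T r w) := by
  refine (((T r).continuous.tendsto w).comp h).congr fun s => ?_
  rw [Function.comp_apply, map_smul, map_sub, hT.apply_apply, hT.apply_apply, add_comm]

theorem HasGenerator.hasDerivWithinAt (hT : IsC0Semigroup T) {v w : X} (h : HasGenerator T v w)
    {t : ℝ} (ht : 0 ≤ t) :
    HasDerivWithinAt (fun τ : ℝ => T τ.toNNReal v) (T t.toNNReal w) (Set.Ioi t) t := by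
  rw [hasDerivWithinAt_iff_tendsto_slope' (by simp)]
  have hshift : Tendsto (fun τ : ℝ => (τ - t).toNNReal) (𝓝[>] t) (𝓝[>] 0) := by
    refine tendsto_nhdsWithin_iff.2 ⟨?_, ?_⟩
    · have : Continuous fun τ : ℝ => (τ - t).toNNReal := by fun_prop
      simpa using (this.tendsto t).mono_left nhdsWithin_le_nhds
    · filter_upwards [self_mem_nhdsWithin] with τ hτ
      simpa using hτ
  refine ((h.semigroup_apply hT t.toNNReal).comp hshift).congr' ?_
  filter_upwards [self_mem_nhdsWithin] with τ hτ
  have hτt : 0 ≤ τ - t := sub_nonneg.2 (le_of_lt hτ)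
  rw [Function.comp_apply, hT.apply_apply, ← Real.toNNReal_add hτt ht, sub_add_cancel,
    slope_def_module, Real.coe_toNNReal _ hτt, ← Complex.ofReal_inv, Complex.coe_smul]

/-- `R l` is the resolvent `(A - il)⁻¹` of the generator `A` of `T`, bounded by `M` uniformly in
`l ∈ ℝ`. The imaginary axis is parametrized by `ℝ`, so that `R` can serve as a Fourier symbol. -/
structure IsResolventFamily (T : ℝ≥0 → X →L[ℂ] X) (R : ℝ → X →L[ℂ] X) (M : ℝ) : Prop where
  resolvent : ∀ l : ℝ, IsResolventAt (generator T) (I * l) (R l)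
  bound : ∀ l, ‖R l‖ ≤ M

theorem exists_isResolventFamily (hspec : opSpectrum (generator T) ∩ imagAxis = ∅)
    (hres : ResolventBddOnImagAxis (generator T)) : ∃ R M, IsResolventFamily T R M := by
  have haxis (l : ℝ) : I * l ∈ imagAxis := by simp [imagAxis]
  have hexists (l : ℝ) : ∃ R, IsResolventAt (generator T) (I * l) R := by
    by_contra h
    exact (hspec ▸ ⟨h, haxis l⟩ : I * (l : ℂ) ∈ (∅ : Set ℂ))
  choose R hR using hexists
  obtain ⟨M, hM⟩ := hres
  exact ⟨R, M, hR, fun l => hM _ (haxis l) _ (hR l)⟩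

namespace IsResolventFamily

variable {R : ℝ → X →L[ℂ] X} {M : ℝ}

theorem bound_nonneg (hR : IsResolventFamily T R M) : 0 ≤ M := (norm_nonneg _).trans (hR.bound 0)

theorem hasGenerator (hR : IsResolventFamily T R M) (l : ℝ) (v : X) :
    HasGenerator T (R l v) (v + (I * l) • R l v) := by
  obtain ⟨hmem, heq⟩ := (hR.resolvent l).1 v
  have h := hasGenerator_generator ⟨R l v, hmem⟩
  rwa [sub_eq_iff_eq_add.1 heq] at h

theorem apply_of_hasGenerator (hR : IsResolventFamily T R M) (l : ℝ) {v w : X}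
    (h : HasGenerator T v w) : R l (w - (I * l) • v) = v := by
  have hinv := (hR.resolvent l).2 ⟨v, w, h⟩
  rwa [(hasGenerator_generator ⟨v, w, h⟩).unique h] at hinv

theorem comm (hR : IsResolventFamily T R M) (hT : IsC0Semigroup T) (l : ℝ) (r : ℝ≥0) (v : X) :
    T r (R l v) = R l (T r v) := by
  have h := hR.apply_of_hasGenerator l ((hR.hasGenerator l v).semigroup_apply hT r)
  rw [map_add, map_smul, add_sub_cancel_right] at h
  exact h.symm

theorem sub_eq (hR : IsResolventFamily T R M) (l l' : ℝ) :
    R l - R l' = (I * (l - l')) • (R l * R l') := by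
  ext v
  have h := hR.apply_of_hasGenerator l (hR.hasGenerator l' v)
  rw [add_sub_assoc, ← sub_smul, map_add, map_smul] at h
  simp only [_root_.sub_apply, _root_.smul_apply, mul_apply_eq_comp]
  nth_rw 1 [← h]
  module

theorem continuous (hR : IsResolventFamily T R M) : Continuous R := by
  have hlip (l l' : ℝ) : dist (R l) (R l') ≤ M * M * dist l l' := by
    rw [dist_eq_norm, hR.sub_eq, norm_smul, norm_mul, Complex.norm_I, one_mul,
      ← Complex.ofReal_sub, Complex.norm_real, ← dist_eq_norm, mul_comm]
    gcongr
    exact norm_mul_le_of_le (hR.bound l) (hR.bound l')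
  exact (LipschitzWith.of_dist_le_mul (K := ⟨M * M, mul_self_nonneg M⟩) hlip).continuous

theorem hasDerivAt (hR : IsResolventFamily T R M) (l : ℝ) :
    HasDerivAt R (I • (R l * R l)) l := by
  rw [hasDerivAt_iff_tendsto_slope]
  have hmul : Continuous fun l' => R l' * R l := hR.continuous.mul continuous_const
  have hcont : Continuous fun l' => I • (R l' * R l) := hmul.const_smul I
  refine ((hcont.tendsto l).mono_left nhdsWithin_le_nhds).congr' ?_
  filter_upwards [self_mem_nhdsWithin] with l' hl'
  have hne : (l' : ℂ) - l ≠ 0 := sub_ne_zero.2 (by exact_mod_cast hl')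
  rw [slope_def_module, hR.sub_eq, ← Complex.coe_smul, smul_smul]
  congr 1
  push_cast
  field_simp

theorem hasDerivAt_pow (hR : IsResolventFamily T R M) (k : ℕ) (l : ℝ) :
    HasDerivAt (fun l => R l ^ k) ((k * I) • R l ^ (k + 1)) l := by
  induction k with
  | zero => simpa using hasDerivAt_const l (1 : X →L[ℂ] X)
  | succ k ih =>
    simp only [pow_succ _ k]
    refine (ih.mul (hR.hasDerivAt l)).congr_deriv ?_
    rw [smul_mul_assoc, mul_smul_comm, ← pow_succ, ← mul_assoc, ← pow_succ, ← pow_succ,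
      ← add_smul]
    push_cast
    ring_nf

theorem iteratedDeriv_eq (hR : IsResolventFamily T R M) (k : ℕ) :
    iteratedDeriv k R = fun l => (k.factorial * I ^ k) • R l ^ (k + 1) := by
  induction k with
  | zero => simp
  | succ k ih =>
    ext1 l
    rw [iteratedDeriv_succ, ih,
      ((hR.hasDerivAt_pow (k + 1) l).fun_const_smul (k.factorial * I ^ k)).deriv, smul_smul,
      Nat.factorial_succ]
    push_cast
    ring_nf

theorem contDiff (hR : IsResolventFamily T R M) (k : ℕ) : ContDiff ℝ k R := by
  refine contDiff_of_differentiable_iteratedDeriv fun m _ l => ?_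
  rw [hR.iteratedDeriv_eq]
  exact ((hR.hasDerivAt_pow (m + 1) l).fun_const_smul (m.factorial * I ^ m)).differentiableAt

theorem norm_iteratedDeriv_le (hR : IsResolventFamily T R M) (k : ℕ) (l : ℝ) :
    ‖iteratedDeriv k R l‖ ≤ k.factorial * M ^ (k + 1) := by
  rw [hR.iteratedDeriv_eq, norm_smul, norm_mul, norm_pow, Complex.norm_I, one_pow, mul_one,
    Complex.norm_natCast]
  gcongr
  exact (norm_pow_le' (R l) k.succ_pos).trans (by gcongr; exact hR.bound l)

end IsResolventFamily

end Semigroup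

/-! ### Integrable kernels from smooth symbols -/

section SmoothSymbol

variable {E : Type*} [NormedAddCommGroup E] [NormedSpace ℂ E]

theorem angFourierInv_iteratedDeriv_two {f : ℝ → E} (hf : ContDiff ℝ 2 f)
    (hint : ∀ k ≤ 2, Integrable (iteratedDeriv k f)) (t : ℝ) :
    angFourierInv (iteratedDeriv 2 f) t = (-(t ^ 2 : ℝ) : ℂ) • angFourierInv f t := by
  have hfourier := congrFun (Real.fourier_iteratedDeriv (N := 2) hf
    (fun k hk => hint k (by exact_mod_cast hk)) le_rfl) (-(t / (2 * Real.pi)))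
  rw [angFourierInv_eq_fourier, angFourierInv_eq_fourier, hfourier, smul_comm]
  congr 1
  have hpi : (Real.pi : ℂ) ≠ 0 := by exact_mod_cast Real.pi_ne_zero
  push_cast
  field_simp
  rw [Complex.I_sq, neg_one_mul]

theorem norm_angFourierInv_le_inv_one_add_sq {f : ℝ → E} (hf : ContDiff ℝ 2 f)
    (hint : ∀ k ≤ 2, Integrable (iteratedDeriv k f)) (t : ℝ) :
    ‖angFourierInv f t‖
      ≤ ((∫ l, ‖f l‖) + ∫ l, ‖iteratedDeriv 2 f l‖) * (1 + t ^ 2)⁻¹ := by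
  have hsq : t ^ 2 * ‖angFourierInv f t‖ ≤ ∫ l, ‖iteratedDeriv 2 f l‖ := by
    have h := norm_angFourierInv_le (iteratedDeriv 2 f) t
    rwa [angFourierInv_iteratedDeriv_two hf hint, norm_smul, norm_neg, Complex.norm_real,
      Real.norm_of_nonneg (sq_nonneg t)] at h
  rw [← div_eq_mul_inv, le_div_iff₀ (by positivity)]
  linarith [norm_angFourierInv_le f t]

theorem integrable_angFourierInv {f : ℝ → E} (hf : ContDiff ℝ 2 f)
    (hint : ∀ k ≤ 2, Integrable (iteratedDeriv k f)) : Integrable (angFourierInv f) :=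
  (integrable_inv_one_add_sq.const_mul _).mono'
    (continuous_angFourierInv (by simpa using hint 0)).aestronglyMeasurable
    (ae_of_all _ (norm_angFourierInv_le_inv_one_add_sq hf hint))

theorem integral_norm_angFourierInv_le {f : ℝ → E} (hf : ContDiff ℝ 2 f)
    (hint : ∀ k ≤ 2, Integrable (iteratedDeriv k f)) :
    ∫ t, ‖angFourierInv f t‖ ≤ ((∫ l, ‖f l‖) + ∫ l, ‖iteratedDeriv 2 f l‖) * Real.pi := by
  rw [← integral_univ_inv_one_add_sq, ← integral_const_mul]
  exact integral_mono (integrable_angFourierInv hf hint).norm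
    (integrable_inv_one_add_sq.const_mul _) (norm_angFourierInv_le_inv_one_add_sq hf hint)

end SmoothSymbol

section Cutoff

variable {E : Type*} [NormedAddCommGroup E] [NormedSpace ℝ E]

theorem integrable_iteratedDeriv_of_hasCompactSupport {f : ℝ → E} {n : ℕ}
    (hf : ContDiff ℝ n f) (hf_supp : HasCompactSupport f) : Integrable (iteratedDeriv n f) := by
  refine (hf.continuous_iteratedDeriv n le_rfl).integrable_of_hasCompactSupport ?_
  rw [iteratedDeriv_eq_equiv_comp]
  exact (hf_supp.iteratedFDeriv n).comp_left (map_zero _)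

theorem norm_iteratedDeriv_smul_le {ψ : ℝ → ℝ} {g : ℝ → E} {n : ℕ} {B : ℝ}
    (hψ : ContDiff ℝ n ψ) (hg : ContDiff ℝ n g)
    (hB : ∀ k ≤ n, ∀ l, ‖iteratedDeriv k g l‖ ≤ B) (l : ℝ) :
    ‖iteratedDeriv n (fun l => ψ l • g l) l‖
      ≤ B * ∑ i ∈ Finset.range (n + 1), n.choose i * ‖iteratedDeriv i ψ l‖ := by
  have h := norm_iteratedFDeriv_smul_le hψ hg l le_rfl
  simp only [norm_iteratedFDeriv_eq_norm_iteratedDeriv] at h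
  rw [Finset.mul_sum]
  refine h.trans (Finset.sum_le_sum fun i _ => ?_)
  rw [mul_comm B]
  gcongr
  exact hB _ (Nat.sub_le n i) l

/-- A bound, in terms of the cut-off function `ψ` alone, for the `L¹`-norm of the `n`-th derivative
of `ψ • g`, where `g` has derivatives of order up to `n` bounded by `1`. -/
noncomputable def leibnizL1 (ψ : ℝ → ℝ) (n : ℕ) : ℝ :=
  ∑ i ∈ Finset.range (n + 1), n.choose i * ∫ l, ‖iteratedDeriv i ψ l‖

theorem leibnizL1_comp_sub_right (ψ : ℝ → ℝ) (n : ℕ) (a : ℝ) :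
    leibnizL1 (fun l => ψ (l - a)) n = leibnizL1 ψ n := by
  simp only [leibnizL1, iteratedDeriv_comp_sub_const]
  congr! 2 with i
  exact integral_sub_right_eq_self (fun l => ‖iteratedDeriv i ψ l‖) a

variable {ψ : ℝ → ℝ} {g : ℝ → E} {n : ℕ} {B : ℝ}

theorem integrable_sum_norm_iteratedDeriv (hψ : ContDiff ℝ n ψ) (hψ_supp : HasCompactSupport ψ) :
    Integrable fun l =>
      B * ∑ i ∈ Finset.range (n + 1), n.choose i * ‖iteratedDeriv i ψ l‖ := by
  refine (integrable_finsetSum _ fun i hi => ?_).const_mul B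
  have hi : i ≤ n := Finset.mem_range_succ_iff.1 hi
  have hψi : ContDiff ℝ i ψ := hψ.of_le (by exact_mod_cast hi)
  exact (integrable_iteratedDeriv_of_hasCompactSupport hψi hψ_supp).norm.const_mul _

theorem integrable_iteratedDeriv_smul (hψ : ContDiff ℝ n ψ) (hψ_supp : HasCompactSupport ψ)
    (hg : ContDiff ℝ n g) (hB : ∀ k ≤ n, ∀ l, ‖iteratedDeriv k g l‖ ≤ B) :
    Integrable (iteratedDeriv n fun l => ψ l • g l) :=
  (integrable_sum_norm_iteratedDeriv hψ hψ_supp).mono'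
    ((hψ.smul hg).continuous_iteratedDeriv n le_rfl).aestronglyMeasurable
    (ae_of_all _ (norm_iteratedDeriv_smul_le hψ hg hB))

theorem integral_norm_iteratedDeriv_smul_le (hψ : ContDiff ℝ n ψ) (hψ_supp : HasCompactSupport ψ)
    (hg : ContDiff ℝ n g) (hB : ∀ k ≤ n, ∀ l, ‖iteratedDeriv k g l‖ ≤ B) :
    ∫ l, ‖iteratedDeriv n (fun l => ψ l • g l) l‖ ≤ B * leibnizL1 ψ n := by
  refine (integral_mono (integrable_iteratedDeriv_smul hψ hψ_supp hg hB).norm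
    (integrable_sum_norm_iteratedDeriv hψ hψ_supp)
    (norm_iteratedDeriv_smul_le hψ hg hB)).trans_eq ?_
  rw [integral_const_mul, integral_finsetSum]
  · simp only [leibnizL1, integral_const_mul]
  · intro i hi
    have hi : i ≤ n := Finset.mem_range_succ_iff.1 hi
    have hψi : ContDiff ℝ i ψ := hψ.of_le (by exact_mod_cast hi)
    exact (integrable_iteratedDeriv_of_hasCompactSupport hψi hψ_supp).norm.const_mul _

/-- A smooth cut-off function, equal to `1` on the support `[-1, 1]` of `triangle`. -/
noncomputable def cutoff : ℝ → ℝ := (⟨1, 2, one_pos, one_lt_two⟩ : ContDiffBump (0 : ℝ))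

theorem contDiff_cutoff_sub (a : ℝ) (n : ℕ) : ContDiff ℝ n fun l => cutoff (l - a) :=
  (ContDiffBump.contDiff _).comp (contDiff_id.sub contDiff_const)

theorem hasCompactSupport_cutoff_sub (a : ℝ) : HasCompactSupport fun l => cutoff (l - a) :=
  (ContDiffBump.hasCompactSupport _).comp_homeomorph (Homeomorph.subRight a)

theorem cutoff_of_abs_le_one {l : ℝ} (h : |l| ≤ 1) : cutoff l = 1 :=
  ContDiffBump.one_of_mem_closedBall _ (by rwa [mem_closedBall_zero_iff])

theorem triangle_smul_cutoff_smul {E : Type*} [NormedAddCommGroup E] [NormedSpace ℂ E]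
    (f : ℝ → E) (a l : ℝ) :
    (triangle (l - a) : ℂ) • cutoff (l - a) • f l = (triangle (l - a) : ℂ) • f l := by
  rcases le_or_gt 1 |l - a| with h | h
  · rw [triangle_of_one_le h, Complex.ofReal_zero, zero_smul, zero_smul]
  · rw [cutoff_of_abs_le_one h.le, one_smul]

end Cutoff

namespace IsResolventFamily

variable {X : Type*} [NormedAddCommGroup X] [NormedSpace ℂ X] {T : ℝ≥0 → X →L[ℂ] X}
  {R : ℝ → X →L[ℂ] X} {M : ℝ}

theorem exists_norm_iteratedDeriv_le (hR : IsResolventFamily T R M) (n : ℕ) :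
    ∃ B : ℝ, ∀ k ≤ n, ∀ l, ‖iteratedDeriv k R l‖ ≤ B := by
  refine ⟨∑ k ∈ Finset.range (n + 1), k.factorial * M ^ (k + 1), fun k hk l => ?_⟩
  refine (hR.norm_iteratedDeriv_le k l).trans ?_
  have hM := hR.bound_nonneg
  exact Finset.single_le_sum (f := fun k : ℕ => (k.factorial : ℝ) * M ^ (k + 1))
    (fun _ _ => by positivity) (Finset.mem_range_succ_iff.2 hk)

theorem integrable_iteratedDeriv_cutoff_smul (hR : IsResolventFamily T R M) (a : ℝ) (n : ℕ) :
    Integrable (iteratedDeriv n fun l => cutoff (l - a) • R l) := by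
  obtain ⟨B, hB⟩ := hR.exists_norm_iteratedDeriv_le n
  exact integrable_iteratedDeriv_smul (contDiff_cutoff_sub a n) (hasCompactSupport_cutoff_sub a)
    (hR.contDiff n) hB

theorem isSymbol_cutoff_smul (hR : IsResolventFamily T R M) (a : ℝ) :
    IsSymbol fun l => cutoff (l - a) • R l where
  integrable := by simpa using hR.integrable_iteratedDeriv_cutoff_smul a 0
  integrable_inv := integrable_angFourierInv ((contDiff_cutoff_sub a 2).smul (hR.contDiff 2))
    fun k _ => hR.integrable_iteratedDeriv_cutoff_smul a k

theorem exists_norm_multiplier_cutoff_smul_le (hR : IsResolventFamily T R M) :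
    ∃ C : ℝ, 0 ≤ C ∧
      ∀ a x, ‖multiplier (fun l => cutoff (l - a) • R l) x‖ ≤ C * ‖x‖ := by
  obtain ⟨B, hB⟩ := hR.exists_norm_iteratedDeriv_le 2
  have hderiv (a : ℝ) (k : ℕ) (hk : k ≤ 2) :
      ∫ l, ‖iteratedDeriv k (fun l => cutoff (l - a) • R l) l‖ ≤ B * leibnizL1 cutoff k := by
    rw [← leibnizL1_comp_sub_right cutoff k a]
    exact integral_norm_iteratedDeriv_smul_le (contDiff_cutoff_sub a k)
      (hasCompactSupport_cutoff_sub a) (hR.contDiff k) fun i hi => hB i (hi.trans hk)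
  have hkernel (a : ℝ) : ∫ t, ‖angFourierInv (fun l => cutoff (l - a) • R l) t‖
      ≤ (B * leibnizL1 cutoff 0 + B * leibnizL1 cutoff 2) * Real.pi := by
    refine (integral_norm_angFourierInv_le ((contDiff_cutoff_sub a 2).smul (hR.contDiff 2))
      fun k _ => hR.integrable_iteratedDeriv_cutoff_smul a k).trans ?_
    gcongr
    · simpa using hderiv a 0 zero_le
    · exact hderiv a 2 le_rfl
  refine ⟨_, (integral_nonneg fun _ => norm_nonneg _).trans (hkernel 0), fun a x => ?_⟩
  exact (norm_convOp_le _ x).trans (by gcongr; exact hkernel a)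

theorem isSymbol_triangle_smul [CompleteSpace X] (hR : IsResolventFamily T R M) (a : ℝ) :
    IsSymbol fun l => (triangle (l - a) : ℂ) • R l := by
  have h := (hR.isSymbol_cutoff_smul a).triangle_smul a
  simp only [triangle_smul_cutoff_smul R] at h
  exact h

theorem multiplier_cutoff_smul_phiC [CompleteSpace X] (hR : IsResolventFamily T R M) (a : ℝ)
    (x : ℝ →ᵇ X) : multiplier (fun l => cutoff (l - a) • R l) (phiC a x)
      = multiplier (fun l => (triangle (l - a) : ℂ) • R l) x := by
  rw [multiplier, convOp_phiC (hR.isSymbol_cutoff_smul a).integrable_inv, ← multiplier,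
    phiC_multiplier (hR.isSymbol_cutoff_smul a)]
  simp only [triangle_smul_cutoff_smul R]

end IsResolventFamily

/-! ### Mild solutions of the linear equation -/

section Mild

variable {X : Type*} [NormedAddCommGroup X] [NormedSpace ℂ X]

/-- `x` is a mild solution of `-x' + A x = y`, where `A` is the generator of `T`: the variation of
constants formula of `IsL`, for functions that need not be bounded. -/
def IsMild (T : ℝ≥0 → X →L[ℂ] X) (x y : ℝ → X) : Prop :=
  ∀ s t : ℝ, s ≤ t → x t = T (t - s).toNNReal (x s) - ∫ τ in s..t, T (t - τ).toNNReal (y τ)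

variable {T : ℝ≥0 → X →L[ℂ] X} {x y x' y' : ℝ → X}

theorem IsMild.comp_sub_right (h : IsMild T x y) (u : ℝ) :
    IsMild T (fun t => x (t - u)) (fun t => y (t - u)) := by
  intro s t hst
  dsimp only
  rw [h (s - u) (t - u) (by gcongr), sub_sub_sub_cancel_right,
    ← intervalIntegral.integral_comp_sub_right]
  simp only [sub_sub_sub_cancel_right]

variable [CompleteSpace X]

theorem IsC0Semigroup.intervalIntegrable_apply_sub (hT : IsC0Semigroup T) (hy : Continuous y)
    (s t r : ℝ) : IntervalIntegrable (fun τ => T (r - τ).toNNReal (y τ)) volume s t :=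
  (hT.continuous_apply (by fun_prop) hy).intervalIntegrable _ _

theorem IsMild.sub (hT : IsC0Semigroup T) (h : IsMild T x y) (h' : IsMild T x' y')
    (hy : Continuous y) (hy' : Continuous y') : IsMild T (x - x') (y - y') := by
  intro s t hst
  simp only [Pi.sub_apply, map_sub]
  rw [intervalIntegral.integral_sub (hT.intervalIntegrable_apply_sub hy s t t)
    (hT.intervalIntegrable_apply_sub hy' s t t), h s t hst, h' s t hst]
  abel

theorem IsMild.right_unique (hT : IsC0Semigroup T) (h : IsMild T x y) (h' : IsMild T x y')
    (hy : Continuous y) (hy' : Continuous y') : y = y' := by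
  ext t
  set g : ℝ → X := fun τ => T (t - τ).toNNReal ((y - y') τ)
  have hg : Continuous g := hT.continuous_apply (by fun_prop) (hy.sub hy')
  have hzero : ∀ s ≤ t, ∫ τ in s..t, g τ = 0 := fun s hst => by
    simpa [g, sub_self x] using h.sub hT h' hy hy' s t hst
  have hderiv : HasDerivWithinAt (fun s => ∫ τ in s..t, g τ) (-g t) (Set.Iic t) t :=
    (intervalIntegral.integral_hasDerivAt_left (hg.intervalIntegrable _ _)
      hg.stronglyMeasurable.stronglyMeasurableAtFilter hg.continuousAt).hasDerivWithinAt
  have hderiv_zero : HasDerivWithinAt (fun s => ∫ τ in s..t, g τ) 0 (Set.Iic t) t :=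
    (hasDerivWithinAt_const t _ 0).congr hzero (hzero t le_rfl)
  have hgt : g t = 0 :=
    neg_eq_zero.1 ((uniqueDiffWithinAt_Iic t).eq_deriv _ hderiv hderiv_zero)
  simpa [g, hT.map_zero, sub_eq_zero] using hgt

theorem IsC0Semigroup.integrable_uncurry_apply_sub (hT : IsC0Semigroup T) {α : Type*}
    [MeasurableSpace α] {μ : Measure α} [SFinite μ] {y : α → ℝ → X} {s t : ℝ}
    (hy : Integrable (fun p : ℝ × α => y p.2 p.1) ((volume.restrict (Set.Ioc s t)).prod μ)) :
    Integrable (Function.uncurry fun τ a => T (t - τ).toNNReal (y a τ))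
      ((volume.restrict (Set.Ioc s t)).prod μ) := by
  obtain ⟨C, -, hC⟩ := hT.exists_bound (t - s).toNNReal
  refine (hy.norm.const_mul C).mono' ?_ ?_
  · exact hT.continuous_uncurry.comp_aestronglyMeasurable (AEStronglyMeasurable.prodMk
      (Continuous.comp_aestronglyMeasurable (g := fun τ : ℝ => (t - τ).toNNReal) (by fun_prop)
        measurable_fst.aestronglyMeasurable) hy.1)
  · have hmem : ∀ᵐ p : ℝ × α ∂(volume.restrict (Set.Ioc s t)).prod μ, p.1 ∈ Set.Ioc s t :=
      Measure.quasiMeasurePreserving_fst.ae (ae_restrict_mem measurableSet_Ioc)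
    filter_upwards [hmem] with p hp
    exact (T _).le_of_opNorm_le (hC _ (Real.toNNReal_le_toNNReal (by linarith [hp.1]))) _

theorem IsMild.integral (hT : IsC0Semigroup T) {α : Type*} [MeasurableSpace α] {μ : Measure α}
    [SFinite μ] {x y : α → ℝ → X} (h : ∀ a, IsMild T (x a) (y a))
    (hx : ∀ t, Integrable (fun a => x a t) μ)
    (hy : ∀ s t, Integrable (fun p : ℝ × α => y p.2 p.1)
      ((volume.restrict (Set.Ioc s t)).prod μ)) :
    IsMild T (fun t => ∫ a, x a t ∂μ) (fun t => ∫ a, y a t ∂μ) := by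
  intro s t hst
  have hTy := hT.integrable_uncurry_apply_sub (hy s t)
  simp only [intervalIntegral.integral_of_le hst]
  calc ∫ a, x a t ∂μ = ∫ a, (T (t - s).toNNReal (x a s) -
        ∫ τ in Set.Ioc s t, T (t - τ).toNNReal (y a τ)) ∂μ := by
        congr! 2 with a
        rw [h a s t hst, intervalIntegral.integral_of_le hst]
    _ = (∫ a, T (t - s).toNNReal (x a s) ∂μ) -
        ∫ a, (∫ τ in Set.Ioc s t, T (t - τ).toNNReal (y a τ)) ∂μ :=
        integral_sub ((T _).integrable_comp (hx s)) hTy.integral_prod_right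
    _ = T (t - s).toNNReal (∫ a, x a s ∂μ) -
        ∫ τ in Set.Ioc s t, (∫ a, T (t - τ).toNNReal (y a τ) ∂μ) := by
        rw [(T _).integral_comp_comm (hx s), integral_integral_swap hTy]
    _ = _ := by
        congr 1
        refine integral_congr_ae ?_
        filter_upwards [(hy s t).prod_right_ae] with τ hτ
        exact (T _).integral_comp_comm hτ

theorem IsMild.hasSum (hT : IsC0Semigroup T) {ι : Type*} [Countable ι] {x y : ι → ℝ →ᵇ X}
    {x₀ y₀ : ℝ →ᵇ X} (h : ∀ i, IsMild T (x i) (y i)) (hx : HasSum x x₀) (hy : HasSum y y₀)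
    (hy_norm : Summable fun i => ‖y i‖) : IsMild T x₀ y₀ := by
  intro s t hst
  obtain ⟨C, -, hC⟩ := hT.exists_bound (t - s).toNNReal
  have heval {f : ι → ℝ →ᵇ X} {f₀ : ℝ →ᵇ X} (hf : HasSum f f₀) (r : ℝ) :
      HasSum (fun i => f i r) (f₀ r) := (BoundedContinuousFunction.evalCLM ℂ r).hasSum hf
  have hint : HasSum (fun i => ∫ τ in s..t, T (t - τ).toNNReal (y i τ))
      (∫ τ in s..t, T (t - τ).toNNReal (y₀ τ)) := by
    refine intervalIntegral.hasSum_integral_of_dominated_convergence (fun i _ => C * ‖y i‖)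
      (fun i => (hT.continuous_apply (by fun_prop) (y i).continuous).aestronglyMeasurable)
      (fun i => ae_of_all _ fun τ hτ => ?_) (ae_of_all _ fun _ _ => hy_norm.mul_left C)
      intervalIntegrable_const (ae_of_all _ fun τ _ => (T _).hasSum (heval hy τ))
    rw [Set.uIoc_of_le hst] at hτ
    exact (T _).le_of_opNorm_le_of_le
      (hC _ (Real.toNNReal_le_toNNReal (by linarith [hτ.1]))) ((y i).norm_coe_le_norm τ)
  refine (heval hx t).unique (((T _).hasSum (heval hx s)).sub hint |>.congr_fun ?_)
  exact fun i => h i s t hst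

/-! ### Convolution of mild solutions -/

theorem IsMild.convOp_left (hT : IsC0Semigroup T) {K J : ℝ → X →L[ℂ] X} (hK : Integrable K)
    (hJ : Integrable J) (h : ∀ v, IsMild T (fun t => K t v) (fun t => J t v)) (y : ℝ →ᵇ X) :
    IsMild T (convOp K y) (convOp J y) := by
  have hconv {N : ℝ → X →L[ℂ] X} (hN : Integrable N) (t : ℝ) :
      convOp N y t = ∫ u, N (t - u) (y u) := by
    rw [convOp_apply hN, ← integral_sub_left_eq_self _ _ t]
    simp only [sub_sub_cancel]
  have hJprod (s t : ℝ) : Integrable (fun p : ℝ × ℝ => J (p.1 - p.2))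
      ((volume.restrict (Set.Ioc s t)).prod volume) := by
    have hshear := measurePreserving_prod_neg_add (volume.restrict (Set.Ioc s t))
      (volume : Measure ℝ)
    simpa [Function.comp_def, neg_add_eq_sub] using
      hshear.integrable_comp_of_integrable (hJ.comp_neg.comp_snd _)
  simp only [funext (hconv hK), funext (hconv hJ)]
  refine IsMild.integral hT (fun u => (h (y u)).comp_sub_right u) (fun t => ?_) fun s t => ?_
  · simpa using (integrable_kernel_apply hK y t).comp_sub_left t
  · exact ((hJprod s t).norm.mul_const ‖y‖).mono'
      ((ContinuousLinearMap.id ℂ (X →L[ℂ] X)).aestronglyMeasurable_comp₂ (hJprod s t).1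
        (y.continuous.comp continuous_snd).aestronglyMeasurable)
      (ae_of_all _ fun p => norm_kernel_apply_le _ y _ _)

theorem IsMild.map (hT : IsC0Semigroup T) {L : X →L[ℂ] X} (hL : ∀ r v, T r (L v) = L (T r v))
    (h : IsMild T x y) (hy : Continuous y) :
    IsMild T (fun t => L (x t)) (fun t => L (y t)) := by
  intro s t hst
  simp only [hL]
  rw [L.intervalIntegral_comp_comm (hT.intervalIntegrable_apply_sub hy s t t), ← map_sub,
    ← h s t hst]

theorem IsMild.convOp_right (hT : IsC0Semigroup T) {K : ℝ → X →L[ℂ] X} (hK : Integrable K)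
    (hKT : ∀ u r v, T r (K u v) = K u (T r v)) {x y : ℝ →ᵇ X} (h : IsMild T x y) :
    IsMild T (convOp K x) (convOp K y) := by
  simp only [funext (convOp_apply hK _)]
  refine IsMild.integral hT (fun u => (h.comp_sub_right u).map hT (hKT u) (by fun_prop))
    (integrable_kernel_apply hK x) fun s t => ?_
  have hKprod : Integrable (fun p : ℝ × ℝ => K p.2)
      ((volume.restrict (Set.Ioc s t)).prod volume) := hK.comp_snd _
  exact (hKprod.norm.mul_const ‖y‖).mono'
    ((ContinuousLinearMap.id ℂ (X →L[ℂ] X)).aestronglyMeasurable_comp₂ hKprod.1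
      (y.continuous.comp (continuous_fst.sub continuous_snd)).aestronglyMeasurable)
    (ae_of_all _ fun p => norm_kernel_apply_le _ y _ _)

end Mild

theorem map_angFourierInv {E F : Type*} [NormedAddCommGroup E] [NormedSpace ℂ E] [CompleteSpace E]
    [NormedAddCommGroup F] [NormedSpace ℂ F] [CompleteSpace F] (L : E →L[ℂ] F) {f : ℝ → E}
    (hf : Integrable f) (t : ℝ) :
    L (angFourierInv f t) = angFourierInv (fun l => L (f l)) t := by
  rw [angFourierInv, map_smul, ← L.integral_comp_comm (integrable_exp_smul hf t)]
  simp only [map_smul, angFourierInv]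

theorem angFourierInv_apply {X : Type*} [NormedAddCommGroup X] [NormedSpace ℂ X] [CompleteSpace X]
    {N : ℝ → X →L[ℂ] X} (hN : Integrable N) (t : ℝ) (v : X) :
    angFourierInv N t v = angFourierInv (fun l => N l v) t :=
  map_angFourierInv (ContinuousLinearMap.apply ℂ X v) hN t

namespace IsResolventFamily

variable {X : Type*} [NormedAddCommGroup X] [NormedSpace ℂ X]
  {T : ℝ≥0 → X →L[ℂ] X} {R : ℝ → X →L[ℂ] X} {M : ℝ}

theorem integrable_apply (hR : IsResolventFamily T R M) {g : ℝ → X} (hg : Integrable g) :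
    Integrable fun l => R l (g l) :=
  (hg.norm.const_mul M).mono'
    ((ContinuousLinearMap.id ℂ (X →L[ℂ] X)).aestronglyMeasurable_comp₂
      hR.continuous.aestronglyMeasurable hg.1)
    (ae_of_all _ fun l => (R l).le_of_opNorm_le (hR.bound l) _)

variable [CompleteSpace X]

theorem integral_exp_smul_semigroup (hR : IsResolventFamily T R M) (hT : IsC0Semigroup T) (l : ℝ)
    {b : ℝ} (hb : 0 ≤ b) (v : X) :
    ∫ τ in (0 : ℝ)..b, exp (-(I * l * τ)) • T τ.toNNReal v
      = exp (-(I * l * b)) • T b.toNNReal (R l v) - R l v := by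
  have hexp : Continuous fun τ : ℝ => exp (-(I * l * τ)) := by fun_prop
  have hcont (w : X) : Continuous fun τ : ℝ => exp (-(I * l * τ)) • T τ.toNNReal w :=
    hexp.smul (hT.continuous_apply continuous_id continuous_const)
  rw [intervalIntegral.integral_eq_sub_of_hasDeriv_right
    (f := fun τ : ℝ => exp (-(I * l * τ)) • T τ.toNNReal (R l v)) (hcont _).continuousOn
    (fun τ hτ => ?_) ((hcont v).intervalIntegrable _ _)]
  · simp [hT.map_zero]
  · rw [min_eq_left hb] at hτ
    have hexp_deriv : HasDerivAt (fun τ : ℝ => exp (-(I * l * τ)))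
        (exp (-(I * l * τ)) * -(I * l * 1)) τ :=
      (((Complex.ofRealCLM.hasDerivAt (x := τ)).const_mul (I * (l : ℂ))).neg).cexp
    refine (hexp_deriv.hasDerivWithinAt.smul
      ((hR.hasGenerator l v).hasDerivWithinAt hT hτ.1.le)).congr_deriv ?_
    rw [map_add, map_smul]
    module

theorem isMild_exp (hR : IsResolventFamily T R M) (hT : IsC0Semigroup T) (l : ℝ) (v : X) :
    IsMild T (fun t => exp (I * l * t) • R l v) (fun t => exp (I * l * t) • v) := by
  intro s t hst
  have hint : ∫ τ in s..t, T (t - τ).toNNReal (exp (I * l * τ) • v)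
      = exp (I * l * t) • ∫ τ in (0 : ℝ)..(t - s), exp (-(I * l * τ)) • T τ.toNNReal v := by
    rw [← sub_self t, ← intervalIntegral.integral_comp_sub_left
      (fun τ : ℝ => exp (-(I * l * τ)) • T τ.toNNReal v), ← intervalIntegral.integral_smul]
    congr! 2 with τ
    rw [map_smul, smul_smul, ← Complex.exp_add]
    congr 2
    push_cast
    ring
  have hexp : I * l * t + -(I * l * ((t - s : ℝ) : ℂ)) = I * l * s := by
    push_cast
    ring
  rw [hint, hR.integral_exp_smul_semigroup hT l (sub_nonneg.2 hst), smul_sub, smul_smul,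
    ← Complex.exp_add, hexp, map_smul]
  abel

theorem isMild_angFourierInv (hR : IsResolventFamily T R M) (hT : IsC0Semigroup T) {g : ℝ → X}
    (hg : Integrable g) : IsMild T (angFourierInv fun l => R l (g l)) (angFourierInv g) := by
  set κ : ℂ := 1 / (2 * Real.pi)
  have hκ (f : ℝ → X) : angFourierInv f = fun t : ℝ => ∫ l : ℝ, exp (I * l * t) • κ • f l := by
    ext t
    rw [angFourierInv, ← integral_smul]
    simp only [smul_comm κ, κ]
  have hκR (l : ℝ) : κ • R l (g l) = R l (κ • g l) := (map_smul _ _ _).symm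
  rw [hκ, hκ]
  simp only [hκR]
  refine IsMild.integral hT (fun l => hR.isMild_exp hT l (κ • g l))
    (fun t => integrable_exp_smul (hR.integrable_apply (hg.smul κ)) t) fun s t => ?_
  exact ((hg.smul κ).comp_snd _).bdd_smul 1 (Continuous.aestronglyMeasurable (by fun_prop))
    (ae_of_all _ fun p => (norm_exp_I_mul p.2 p.1).le)

theorem isMild_multiplier (hR : IsResolventFamily T R M) (hT : IsC0Semigroup T) (a : ℝ)
    (y : ℝ →ᵇ X) :
    IsMild T (multiplier (fun l => (triangle (l - a) : ℂ) • R l) y) (phiC a y) := by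
  refine IsMild.convOp_left hT (hR.isSymbol_triangle_smul a).integrable_inv
    (integrable_phi_smul_one a) (fun v => ?_) y
  have h := hR.isMild_angFourierInv hT ((integrable_triangle_sub a).smul_const v)
  convert h using 2 with t t
  · rw [angFourierInv_apply (hR.isSymbol_triangle_smul a).integrable]
    simp only [map_smul, FunLike.coe_smul, Pi.smul_apply]
  · rw [congrFun (phi_smul_one_eq_angFourierInv a) t,
      angFourierInv_apply (isSymbol_triangle_smul_one a).integrable]
    rfl

theorem angFourierInv_comm (hR : IsResolventFamily T R M) (hT : IsC0Semigroup T) (a u : ℝ)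
    (r : ℝ≥0) (v : X) :
    T r (angFourierInv (fun l => (triangle (l - a) : ℂ) • R l) u v)
      = angFourierInv (fun l => (triangle (l - a) : ℂ) • R l) u (T r v) := by
  have hint := (hR.isSymbol_triangle_smul a).integrable
  rw [angFourierInv_apply hint, angFourierInv_apply hint,
    map_angFourierInv _ (hint.apply_continuousLinearMap v)]
  simp only [FunLike.coe_smul, Pi.smul_apply, map_smul, hR.comm hT]

theorem isMild_left_unique (hR : IsResolventFamily T R M) (hT : IsC0Semigroup T)
    {x x' y : ℝ →ᵇ X} (h : IsMild T x y) (h' : IsMild T x' y) : x = x' := by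
  refine sub_eq_zero.1 (eq_zero_of_phiC_eq_zero fun a => ?_)
  set K := angFourierInv fun l => (triangle (l - a) : ℂ) • R l
  have hK : Integrable K := (hR.isSymbol_triangle_smul a).integrable_inv
  have horbit : IsMild T (x - x') (0 : ℝ →ᵇ X) := by
    simpa using h.sub hT h' y.continuous y.continuous
  have hzero : IsMild T (convOp K (x - x')) (convOp K (0 : ℝ →ᵇ X)) :=
    IsMild.convOp_right hT hK (hR.angFourierInv_comm hT a) horbit
  have h := (hR.isMild_multiplier hT a (x - x')).right_unique hT hzero
    (BoundedContinuousFunction.continuous _) (BoundedContinuousFunction.continuous _)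
  rw [map_zero] at h
  exact DFunLike.coe_injective h

theorem asNorm_multiplier_triangle_smul_le (hR : IsResolventFamily T R M) :
    ∃ C, 0 ≤ C ∧ ∀ (n : ℤ) (y : ℝ →ᵇ X),
      asNorm (multiplier (fun l => (triangle (l - n) : ℂ) • R l) y)
        ≤ ENNReal.ofReal (C * ‖phiC n y‖) := by
  obtain ⟨C, hC, hbound⟩ := hR.exists_norm_multiplier_cutoff_smul_le
  refine ⟨(2 * (2 : ℕ) + 1) * (5 * (phiL1 * C)), by have := phiL1_nonneg; positivity,
    fun n y => ?_⟩
  rw [← hR.multiplier_cutoff_smul_phiC]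
  refine (asNorm_le_of_phiC_eq_zero n 2 fun m hm => ?_).trans (ENNReal.ofReal_le_ofReal ?_)
  · rw [multiplier, ← convOp_phiC (hR.isSymbol_cutoff_smul n).integrable_inv,
      phiC_phiC_eq_zero hm, map_zero]
  · simp only [mul_assoc]
    have := phiL1_nonneg
    gcongr
    exact hbound n _

theorem exists_isMild_norm_le (hR : IsResolventFamily T R M) (hT : IsC0Semigroup T) :
    ∃ C, 0 ≤ C ∧ ∀ y : ASpace X, ∃ x : ASpace X,
      ‖x‖ ≤ C * ‖y‖ ∧ IsMild T (ASpace.incl X x) (ASpace.incl X y) := by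
  obtain ⟨C, hC, hbound⟩ := hR.asNorm_multiplier_triangle_smul_le
  refine ⟨C, hC, fun y => ?_⟩
  have hpiece (n : ℤ) : ∃ x : ASpace X, ‖x‖ ≤ C * ‖phiC n (ASpace.incl X y)‖ ∧
      ASpace.incl X x
        = multiplier (fun l => (triangle (l - n) : ℂ) • R l) (ASpace.incl X y) := by
    obtain ⟨x, hx⟩ := ASpace.exists_incl_eq (memAS_of_asNorm_lt_top
      ((hbound n (ASpace.incl X y)).trans_lt ENNReal.ofReal_lt_top))
    refine ⟨x, (ASpace.norm_le_iff (by positivity)).2 ?_, hx⟩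
    rw [hx]
    exact hbound n _
  choose x hx_norm hx using hpiece
  have hy_norm := summable_norm_phiC (ASpace.memAS_incl y)
  have hbound_sum : HasSum (fun n : ℤ => C * ‖phiC n (ASpace.incl X y)‖) _ :=
    hy_norm.hasSum.mul_left C
  have hx_sum : Summable x := hbound_sum.summable.of_norm_bounded hx_norm
  refine ⟨∑' n, x n, (tsum_of_norm_bounded hbound_sum hx_norm).trans ?_, ?_⟩
  · gcongr
    exact hy_norm.tsum_le_of_sum_le (ASpace.sum_norm_phiC_le y)
  · refine IsMild.hasSum hT (fun n => ?_) (ASpace.inclL.hasSum hx_sum.hasSum)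
      (hasSum_phiC (ASpace.memAS_incl y)) hy_norm
    exact hx n ▸ hR.isMild_multiplier hT n _

theorem existsUnique_isL (hR : IsResolventFamily T R M) (hT : IsC0Semigroup T) {y : ℝ →ᵇ X}
    (hy : MemAS y) : ∃! x, IsL T x y := by
  obtain ⟨C, -, hC⟩ := hR.exists_isMild_norm_le hT
  obtain ⟨y, rfl⟩ := ASpace.exists_incl_eq hy
  obtain ⟨x, -, hx⟩ := hC y
  exact ⟨ASpace.incl X x, ⟨ASpace.memAS_incl x, hy, hx⟩,
    fun x' hx' => hR.isMild_left_unique hT hx'.2.2 hx⟩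

theorem isL_LInv (hR : IsResolventFamily T R M) (hT : IsC0Semigroup T) {y : ℝ →ᵇ X}
    (hy : MemAS y) : IsL T (LInv T y) y := by
  have h := (hR.existsUnique_isL hT hy).exists
  rw [LInv, dif_pos h]
  exact Classical.choose_spec h

theorem exists_lipschitzWith_incl_eq_LInv (hR : IsResolventFamily T R M) (hT : IsC0Semigroup T) :
    ∃ (C : ℝ≥0) (G : ASpace X → ASpace X), LipschitzWith C G ∧
      ∀ y, ASpace.incl X (G y) = LInv T (ASpace.incl X y) := by
  obtain ⟨C, hC, hbound⟩ := hR.exists_isMild_norm_le hT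
  have hLInv (y : ASpace X) := hR.isL_LInv hT (ASpace.memAS_incl y)
  choose G hG using fun y => ASpace.exists_incl_eq (hLInv y).1
  refine ⟨⟨C, hC⟩, G, LipschitzWith.of_dist_le_mul fun u v => ?_, hG⟩
  obtain ⟨w, hw_norm, hw⟩ := hbound (u - v)
  have hsub : IsMild T (ASpace.incl X (G u - G v)) (ASpace.incl X (u - v)) := by
    rw [map_sub, map_sub, hG, hG]
    exact IsMild.sub hT (hLInv u).2.2 (hLInv v).2.2 (ASpace.incl X u).continuous
      (ASpace.incl X v).continuous
  have hw_eq : G u - G v = w := ASpace.incl_injective (hR.isMild_left_unique hT hsub hw)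
  rwa [dist_eq_norm, dist_eq_norm, hw_eq]

end IsResolventFamily

/-! ### Mild solutions of the non-linear equation -/

theorem existsUnique_mem_closedBall_eq_add {E : Type*} [NormedAddCommGroup E] [NormedSpace ℝ E]
    [CompleteSpace E] {Φ : E → E} (hΦ : Continuous Φ) {z : E} {β : ℝ} (hβ : 0 < β) {K : ℝ≥0}
    (hK : K < 1) (hLip : LipschitzOnWith K Φ (Metric.ball z β)) (hz : ‖Φ z‖ ≤ β * (1 - K)) :
    ∃! x, x ∈ Metric.closedBall z β ∧ x = z + Φ x := by
  have hLip_closed : LipschitzOnWith K (fun x => z + Φ x) (Metric.closedBall z β) := by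
    rw [← closure_ball z hβ.ne']
    refine LipschitzOnWith.closure (by fun_prop) fun u hu v hv => ?_
    simpa using hLip hu hv
  have hmaps : Set.MapsTo (fun x => z + Φ x) (Metric.closedBall z β) (Metric.closedBall z β) := by
    intro x hx
    have hxz := hLip_closed.dist_le_mul x hx z (Metric.mem_closedBall_self hβ.le)
    rw [Metric.mem_closedBall] at hx ⊢
    calc dist (z + Φ x) z ≤ dist (z + Φ x) (z + Φ z) + dist (z + Φ z) z := dist_triangle _ _ _
      _ ≤ K * β + β * (1 - K) := by
          rw [dist_self_add_left]
          gcongr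
          exact hxz.trans (by gcongr)
      _ = β := by ring
  have hcontr : ContractingWith K (hmaps.restrict _ _ _) :=
    ⟨hK, hLip_closed.mapsToRestrict hmaps⟩
  obtain ⟨x, hx, hfix, -⟩ := hcontr.exists_fixedPoint' Metric.isClosed_closedBall.isComplete hmaps
    (Metric.mem_closedBall_self hβ.le) (edist_ne_top _ _)
  refine ⟨x, ⟨hx, hfix.symm⟩, fun x' ⟨hx', hfix'⟩ => ?_⟩
  exact congrArg Subtype.val (hcontr.fixedPoint_unique' (x := ⟨x', hx'⟩) (y := ⟨x, hx⟩)
    (Subtype.ext hfix'.symm) (Subtype.ext hfix))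

section Nonlinear

variable {X : Type*} [NormedAddCommGroup X] [NormedSpace ℂ X] [CompleteSpace X]
  {T : ℝ≥0 → X →L[ℂ] X} {R : ℝ → X →L[ℂ] X} {M : ℝ}

theorem MemAS.polyComp {x : ℝ →ᵇ X} (hx : MemAS x) (n : ℕ)
    (F : (k : ℕ) → ContinuousMultilinearMap ℂ (fun _ : Fin k => X) X) :
    MemAS (polyComp n F x) := by
  obtain ⟨u, rfl⟩ := ASpace.exists_incl_eq hx
  exact ASpace.incl_polyCompAS n F u ▸ ASpace.memAS_incl _

theorem IsResolventFamily.existsUnique_isMildSolution (hR : IsResolventFamily T R M)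
    (hT : IsC0Semigroup T) {n : ℕ} {F : (k : ℕ) → ContinuousMultilinearMap ℂ (fun _ : Fin k => X) X}
    {β : ℝ} (hβ : 0 < β) {K : ℝ≥0} (hK : K < 1) {y : ℝ →ᵇ X} (hy : MemAS y)
    (hLip : AsLipschitzOn K (Phi T n F) (asBall (LInv T y) β))
    (hz : asNorm (Phi T n F (LInv T y)) ≤ ENNReal.ofReal (β * (1 - K))) :
    ∃! x : ℝ →ᵇ X, IsMildSolution T n F y x ∧ asNorm (x - LInv T y) ≤ ENNReal.ofReal β := by
  obtain ⟨C, G, hG, hG_incl⟩ := hR.exists_lipschitzWith_incl_eq_LInv hT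
  obtain ⟨y, rfl⟩ := ASpace.exists_incl_eq hy
  set Φ : ASpace X → ASpace X := fun u => G (ASpace.polyCompAS n F u)
  have hΦ (u : ASpace X) : ASpace.incl X (Φ u) = Phi T n F (ASpace.incl X u) := by
    rw [hG_incl, ASpace.incl_polyCompAS, Phi]
  rw [← hG_incl] at hLip hz ⊢
  have hball {u : ASpace X} (hu : u ∈ Metric.ball (G y) β) :
      ASpace.incl X u ∈ asBall (ASpace.incl X (G y)) β := by
    refine ⟨ASpace.memAS_incl u, ?_⟩
    rwa [← map_sub, ASpace.asNorm_incl, ENNReal.ofReal_lt_ofReal_iff hβ, ← dist_eq_norm]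
  have hΦ_lip : LipschitzOnWith K Φ (Metric.ball (G y) β) := by
    intro u hu v hv
    have h := hLip _ (hball hu) _ (hball hv)
    rwa [← hΦ, ← hΦ, ← map_sub, ← map_sub, ASpace.asNorm_incl, ASpace.asNorm_incl,
      ← dist_eq_norm, ← dist_eq_norm, ← edist_dist, ← edist_dist] at h
  have hΦ_z : ‖Φ (G y)‖ ≤ β * (1 - K) := by
    have hK' : (0 : ℝ) ≤ 1 - K := sub_nonneg.2 (by exact_mod_cast hK.le)
    rwa [ASpace.norm_le_iff (by positivity), hΦ]
  have hsol (u : ASpace X) : IsMildSolution T n F (ASpace.incl X y) (ASpace.incl X u) ∧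
      asNorm (ASpace.incl X u - ASpace.incl X (G y)) ≤ ENNReal.ofReal β ↔
      u ∈ Metric.closedBall (G y) β ∧ u = G y + Φ u := by
    rw [IsMildSolution, ← hG_incl, ← hΦ, ← map_add, ASpace.incl_injective.eq_iff, ← map_sub,
      ← ASpace.norm_le_iff hβ.le, mem_closedBall_iff_norm, and_comm,
      and_iff_right (ASpace.memAS_incl u)]
  obtain ⟨u, hu, hu_unique⟩ := existsUnique_mem_closedBall_eq_add
    (hG.continuous.comp (ASpace.continuous_polyCompAS n F)) hβ hK hΦ_lip hΦ_z
  refine ⟨ASpace.incl X u, (hsol u).2 hu, fun x hx => ?_⟩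
  obtain ⟨v, rfl⟩ := ASpace.exists_incl_eq hx.1.1
  rw [hu_unique v ((hsol v).1 hx)]

end Nonlinear

end ParabolicAS

theorem theorem5p1 {X : Type*} [NormedAddCommGroup X] [NormedSpace ℂ X] [CompleteSpace X]
    (T : ℝ≥0 → X →L[ℂ] X) (hT : ParabolicAS.IsC0Semigroup T)
    (hspec : ParabolicAS.opSpectrum (ParabolicAS.generator T) ∩ ParabolicAS.imagAxis = ∅)
    (hres : ParabolicAS.ResolventBddOnImagAxis (ParabolicAS.generator T))
    (n : ℕ) (F : (k : ℕ) → ContinuousMultilinearMap ℂ (fun _ : Fin k => X) X) :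
    -- `L⁻¹` is well defined on `F_as`, and `F` maps `F_as` to itself
    (∀ y : ℝ →ᵇ X, ParabolicAS.MemAS y → ∃! x : ℝ →ᵇ X, ParabolicAS.IsL T x y) ∧
    (∀ x : ℝ →ᵇ X, ParabolicAS.MemAS x → ParabolicAS.MemAS (ParabolicAS.polyComp n F x)) ∧
    -- existence, uniqueness and localization of the mild solution
    ∀ (β : ℝ) (K : ℝ≥0) (y : ℝ →ᵇ X), 0 < β → K < 1 → ParabolicAS.MemAS y →
      ParabolicAS.AsLipschitzOn K (ParabolicAS.Phi T n F)
        (ParabolicAS.asBall (ParabolicAS.LInv T y) β) →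
      ParabolicAS.asNorm (ParabolicAS.Phi T n F (ParabolicAS.LInv T y))
        < ENNReal.ofReal (β * (1 - K)) →
      ∃! x : ℝ →ᵇ X, ParabolicAS.IsMildSolution T n F y x ∧
        ParabolicAS.asNorm (x - ParabolicAS.LInv T y) ≤ ENNReal.ofReal β := by
  obtain ⟨R, M, hR⟩ := ParabolicAS.exists_isResolventFamily hspec hres
  exact ⟨fun y hy => hR.existsUnique_isL hT hy, fun x hx => hx.polyComp n F,
    fun β K y hβ hK hy hLip hΦ => hR.existsUnique_isMildSolution hT hβ hK hy hLip hΦ.le⟩
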